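/- Let $\mathcal P$ be the Banach space of $C^2$ functions $V:\mathbb R\to\mathbb R$ with $\|V\|_2=\sup_{x}\max\{|V(x)|,|V'(x)|,|V''(x)|\}<\infty$. For $T>0$ and $n\in\mathbb N$ let $C^+_{T,n}$ be the Banach space of even, $T$-periodic $C^n$ functions $q:\mathbb R\to\mathbb R$ with the uniform $C^n$ norm, and let $F:C^+_{T,2}\times\mathcal P\to C^+_{T,0}$, $F(q,V)=\ddot q+V'(q)$. We say that $V\in\mathcal P$ is *anharmonic* at $q\in C^+_{T,2}$ if $q$ is nonconstant, $F(q,V)=0$ and the partial derivative $DF_{(q,V)}:C^+_{T,2}\to C^+_{T,0}$ of $F$ with respect to $q$ has kernel $\{0\}$. For $T\in 2\pi\mathbb Z^+$, $V$ is *degenerate* at $q$ if $V$ is anharmonic at $q$ and $\int_0^T\cos t\;q(t)\,dt=0$. A *perturbation neighbourhood* of $(q_0,V_0)$ is a pair $(\mathcal U,f)$ where $\mathcal U\subset\mathcal P$ is an open set containing $V_0$ and $f:\mathcal U\to C^+_{T,2}$ is a $C^1$ map such that every $W\in\mathcal U$ is anharmonic at $f(W)$, and $f(V_0)=q_0$.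 **Theorem.** Let $T\in 2\pi\mathbb Z^+$, let $V_0\in\mathcal P$ be degenerate at $q_0\in C^+_{T,2}$, and let $(\mathcal U,f)$ be a perturbation neighbourhood of $(q_0,V_0)$. Assume that every connected component of $\mathcal U$ contains some $W$ for which the minimal period of $f(W)$ belongs to $2\pi\mathbb Z^+$. (If $\mathcal U$ is connected, it is enough that $T$ is the minimal period of $q_0$.) Put $\mathcal D=\{V\in\mathcal U: V\text{ is degenerate at } f(V)\}$. Then: 1. $\mathcal D$ is a $C^1$ submanifold of $\mathcal U$ of codimension $1$: around each point of $\mathcal D$ there is a $C^1$ diffeomorphism from an open subset of $\mathcal U$ onto an open subset of $\mathcal P$ that takes $\mathcal D$ to a closed linear subspace of codimension $1$. 2. Sign changes of $\chi_1(0)$ at the period $T$ are generic: $\mathcal U\setminus\mathcal D$ is open, and dense in $\mathcal U$, and for every $V\in\mathcal U\setminus\mathcal D$ the following holds. For some $\delta>0$ there is a family $(x_\tau)_{|\tau-T|<\delta}$ of even, $\tau$-periodic $C^2$ solutions of $\ddot x+V'(x)=0$ with $x_T=f(V)$ and $(\tau,t)\mapsto x_\tau(t)$ continuous. For every such family (and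 every $\delta>0$), for all $\tau\neq T$ close enough to $T$ the equation $\ddot\chi_1+\chi_1=x_\tau$ has exactly one even $\tau$-periodic $C^2$ solution $\chi_1$; and its initial value $\chi_1(0)$, as a function of $\tau$, either tends to $-\infty$ as $\tau\to T^-$ and to $+\infty$ as $\tau\to T^+$, or tends to $+\infty$ as $\tau\to T^-$ and to $-\infty$ as $\tau\to T^+$. -/

import Mathlib

open Set Filter Topology
open scoped BoundedContinuousFunction

noncomputable section

namespace Breather

/-! ### The Banach spaces of potentials and of even periodic functions -/

/-- The linear space of `n` times continuously differentiable functions `ℝ → ℝ` all of whose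
derivatives of order `0, …, n` are bounded. -/
def boundedContDiff (n : ℕ) : Submodule ℝ (ℝ → ℝ) where
  carrier := {f | ContDiff ℝ n f ∧ ∀ k ≤ n, ∃ C : ℝ, ∀ x, ‖iteratedDeriv k f x‖ ≤ C}
  zero_mem' := by
    refine ⟨contDiff_const, fun k _ => ⟨0, fun x => ?_⟩⟩
    have h : iteratedDeriv k (0 : ℝ → ℝ) x = 0 := by
      simp [Pi.zero_def]
    simp [h]
  add_mem' := by
    rintro f g ⟨hf, hf'⟩ ⟨hg, hg'⟩
    refine ⟨hf.add hg, fun k hk => ?_⟩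
    obtain ⟨C, hC⟩ := hf' k hk
    obtain ⟨D, hD⟩ := hg' k hk
    refine ⟨C + D, fun x => ?_⟩
    have hk' : (k : WithTop ℕ∞) ≤ n := by exact_mod_cast hk
    rw [iteratedDeriv_add (hf.of_le hk').contDiffAt (hg.of_le hk').contDiffAt]
    exact (norm_add_le _ _).trans (add_le_add (hC x) (hD x))
  smul_mem' := by
    rintro c f ⟨hf, hf'⟩
    refine ⟨hf.const_smul c, fun k hk => ?_⟩
    obtain ⟨C, hC⟩ := hf' k hk
    refine ⟨‖c‖ * C, fun x => ?_⟩
    have hk' : (k : WithTop ℕ∞) ≤ n := by exact_mod_cast hk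
    rw [iteratedDeriv_const_smul (hf.of_le hk').contDiffAt c, norm_smul]
    exact mul_le_mul_of_nonneg_left (hC x) (norm_nonneg c)

/-- The space of `C^n` functions `ℝ → ℝ` with finite `C^n` norm. It is kept separate from the
subtype `boundedContDiff n`, whose default topology is that of pointwise convergence. -/
def Cb (n : ℕ) : Type := boundedContDiff n

instance (n : ℕ) : AddCommGroup (Cb n) := inferInstanceAs (AddCommGroup (boundedContDiff n))
instance (n : ℕ) : Module ℝ (Cb n) := inferInstanceAs (Module ℝ (boundedContDiff n))
instance (n : ℕ) : CoeFun (Cb n) (fun _ => ℝ → ℝ) := ⟨fun f => f.1⟩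

/-- The derivatives `f, f', …, f^(n)` as bounded continuous functions. -/
def Cb.jet (n : ℕ) : Cb n →ₗ[ℝ] (Fin (n + 1) → (ℝ →ᵇ ℝ)) where
  toFun f := fun k => BoundedContinuousFunction.ofNormedAddCommGroup (iteratedDeriv k f.1)
    (f.2.1.continuous_iteratedDeriv k (by exact_mod_cast Nat.lt_succ_iff.mp k.2))
    (f.2.2 k (Nat.lt_succ_iff.mp k.2)).choose
    (f.2.2 k (Nat.lt_succ_iff.mp k.2)).choose_spec
  map_add' f g := by
    funext k
    ext x
    have hk : ((k : ℕ) : WithTop ℕ∞) ≤ n := by exact_mod_cast Nat.lt_succ_iff.mp k.2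
    exact iteratedDeriv_add (f.2.1.of_le hk).contDiffAt (g.2.1.of_le hk).contDiffAt
  map_smul' c f := by
    funext k
    ext x
    have hk : ((k : ℕ) : WithTop ℕ∞) ≤ n := by exact_mod_cast Nat.lt_succ_iff.mp k.2
    exact iteratedDeriv_const_smul (f.2.1.of_le hk).contDiffAt c

theorem Cb.jet_injective (n : ℕ) : Function.Injective (Cb.jet n) := by
  intro f g h
  apply Subtype.ext
  funext x
  have h0 := DFunLike.congr_fun (congrFun h 0) x
  simpa [Cb.jet] using h0

/-- The uniform `C^n` norm `sup_x max (|f x|, |f' x|, …, |f^(n) x|)`. -/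
instance (n : ℕ) : NormedAddCommGroup (Cb n) :=
  NormedAddCommGroup.induced (Cb n) (Fin (n + 1) → (ℝ →ᵇ ℝ)) (Cb.jet n) (Cb.jet_injective n)

instance (n : ℕ) : NormedSpace ℝ (Cb n) :=
  NormedSpace.induced ℝ (Cb n) (Fin (n + 1) → (ℝ →ᵇ ℝ)) (Cb.jet n)

/-- The space of potentials: `C^2` functions with finite `C^2` norm. -/
abbrev Potential : Type := Cb 2

/-- The space `C^+_{T,n}` of even, `T`-periodic, `n` times continuously differentiable functions,
with the uniform `C^n` norm. (For `T > 0` periodicity makes all these derivatives bounded.) -/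
def EvenPeriodic (T : ℝ) (n : ℕ) : Submodule ℝ (Cb n) where
  carrier := {q | Function.Periodic q T ∧ Function.Even q}
  zero_mem' := ⟨fun _ => rfl, fun _ => rfl⟩
  add_mem' := by
    rintro p q ⟨hp, hp'⟩ ⟨hq, hq'⟩
    exact ⟨hp.add hq, fun x => congrArg₂ (· + ·) (hp' x) (hq' x)⟩
  smul_mem' := by
    rintro c q ⟨hq, hq'⟩
    exact ⟨fun x => congrArg (c * ·) (hq x), fun x => congrArg (c * ·) (hq' x)⟩

instance (T : ℝ) (n : ℕ) : CoeFun (EvenPeriodic T n) (fun _ => ℝ → ℝ) := ⟨fun q => q.1.1⟩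

/-! ### Newton's equation as a map between Banach spaces -/

/-- The map `F(q, V) = q'' + V'(q)` from `C^+_{T,2} × Potential` to `C^+_{T,0}`. -/
def newton {T : ℝ} (q : EvenPeriodic T 2) (V : Potential) : EvenPeriodic T 0 :=
  ⟨⟨fun t => iteratedDeriv 2 q t + deriv V (q t), by
    have hc : Continuous fun t => iteratedDeriv 2 q t + deriv V (q t) :=
      (q.1.2.1.continuous_iteratedDeriv 2 le_rfl).add
        ((V.2.1.continuous_deriv (by norm_num)).comp q.1.2.1.continuous)
    refine ⟨contDiff_zero.2 hc, fun k hk => ?_⟩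
    obtain rfl : k = 0 := Nat.le_zero.mp hk
    obtain ⟨C, hC⟩ := q.1.2.2 2 le_rfl
    obtain ⟨D, hD⟩ := V.2.2 1 one_le_two
    refine ⟨C + D, fun t => ?_⟩
    have h1 : ‖deriv V (q t)‖ ≤ D := by simpa [iteratedDeriv_one] using hD (q t)
    simpa only [iteratedDeriv_zero] using
      (norm_add_le _ _).trans (add_le_add (hC t) h1)⟩, by
    constructor
    · intro t
      have h : iteratedDeriv 2 q (t + T) = iteratedDeriv 2 q t := by
        rw [← congrFun (iteratedDeriv_comp_add_const 2 q T) t, funext q.2.1]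
      exact congrArg₂ (· + ·) h (congrArg (deriv V) (q.2.1 t))
    · intro t
      have h : iteratedDeriv 2 q (-t) = iteratedDeriv 2 q t := by
        have h2 := iteratedDeriv_comp_neg 2 q t
        rw [funext q.2.2] at h2
        simpa using h2.symm
      exact congrArg₂ (· + ·) h (congrArg (deriv V) (q.2.2 t))⟩

/-- `V` is anharmonic at `q`: `q` is a nonconstant solution of Newton's equation in the
potential `V`, and the partial derivative of `F` in the direction of `q` is injective. -/
def IsAnharmonic {T : ℝ} (V : Potential) (q : EvenPeriodic T 2) : Prop :=
  (¬ ∃ c : ℝ, ∀ t, q t = c) ∧ newton q V = 0 ∧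
    (fderiv ℝ (fun p : EvenPeriodic T 2 => newton p V) q).ker = ⊥

/-- `V` is degenerate at `q` (used for `T` a positive integer multiple of `2π`). -/
def IsDegenerate {T : ℝ} (V : Potential) (q : EvenPeriodic T 2) : Prop :=
  IsAnharmonic V q ∧ ∫ t in (0 : ℝ)..T, Real.cos t * q t = 0

/-- `(U, f)` is a perturbation neighbourhood of `(q, V)`. -/
def IsPerturbationNhd {T : ℝ} (U : Set Potential) (f : Potential → EvenPeriodic T 2)
    (q : EvenPeriodic T 2) (V : Potential) : Prop :=
  IsOpen U ∧ V ∈ U ∧ ContDiffOn ℝ 1 f U ∧ (∀ W ∈ U, IsAnharmonic W (f W)) ∧ f V = q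

/-- `T` is a positive integer multiple of `2π`. -/
def IsResonant (T : ℝ) : Prop := ∃ n : ℕ, 0 < n ∧ T = 2 * Real.pi * n

/-- `p` is the least positive period of `q`. -/
def IsMinimalPeriod (q : ℝ → ℝ) (p : ℝ) : Prop :=
  0 < p ∧ Function.Periodic q p ∧ ∀ r, 0 < r → r < p → ¬ Function.Periodic q r

/-! ### Submanifolds -/

/-- `S` is a `C^1` submanifold of codimension `k` of the open subset `U` of the normed space `E`:
around each of its points there is a `C^1` diffeomorphism `φ` between open subsets of `U` and of
`E` that straightens `S` to a closed linear subspace `N` of codimension `k`. (A closed subspace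
of finite codimension splits.) -/
def IsSubmanifoldOfCodim {E : Type*} [NormedAddCommGroup E] [NormedSpace ℝ E]
    (k : ℕ) (U S : Set E) : Prop :=
  S ⊆ U ∧ ∀ p ∈ S, ∃ (φ : OpenPartialHomeomorph E E) (N : Submodule ℝ E),
    p ∈ φ.source ∧ φ.source ⊆ U ∧
    ContDiffOn ℝ 1 φ φ.source ∧ ContDiffOn ℝ 1 φ.symm φ.target ∧
    IsClosed (N : Set E) ∧ Module.rank ℝ (E ⧸ N) = k ∧
    ∀ x ∈ φ.source, x ∈ S ↔ φ x ∈ N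

/-! ### The initial value of the off-central tangent component -/

/-- `x` is an even, `τ`-periodic `C^2` solution of `x'' + V'(x) = 0`. -/
def IsEvenOscillation (V : Potential) (τ : ℝ) (x : ℝ → ℝ) : Prop :=
  ContDiff ℝ 2 x ∧ Function.Even x ∧ Function.Periodic x τ ∧
    ∀ t, iteratedDeriv 2 x t + deriv V (x t) = 0

/-- `x τ`, for `|τ - T| < δ`, is a continuous family of even oscillations of period `τ` in the
potential `V` that passes through `q` at `τ = T`. -/
def IsOscillationFamily (V : Potential) (T : ℝ) (q : ℝ → ℝ) (δ : ℝ) (x : ℝ → ℝ → ℝ) : Prop :=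
  x T = q ∧
  ContinuousOn (fun z : ℝ × ℝ => x z.1 z.2) (Ioo (T - δ) (T + δ) ×ˢ univ) ∧
  ∀ τ ∈ Ioo (T - δ) (T + δ), IsEvenOscillation V τ (x τ)

/-- `χ` is an even, `τ`-periodic `C^2` solution of `χ'' + χ = x`. -/
def IsOffCentral (τ : ℝ) (x χ : ℝ → ℝ) : Prop :=
  ContDiff ℝ 2 χ ∧ Function.Even χ ∧ Function.Periodic χ τ ∧
    ∀ t, iteratedDeriv 2 χ t + χ t = x t

/-- Along the family `x`, the initial value `χ₁(0)`, as a function of the period `τ`, is well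
defined for `τ ≠ T` near `T` and has a vertical asymptote with a change of sign at `T`. -/
def HasSignChangeAt (T : ℝ) (x : ℝ → ℝ → ℝ) : Prop :=
  ∃ c : ℝ → ℝ,
    (∀ᶠ τ in 𝓝[≠] T, (∃! χ : ℝ → ℝ, IsOffCentral τ (x τ) χ) ∧
      ∀ χ : ℝ → ℝ, IsOffCentral τ (x τ) χ → χ 0 = c τ) ∧
    ((Tendsto c (𝓝[<] T) atBot ∧ Tendsto c (𝓝[>] T) atTop) ∨
      (Tendsto c (𝓝[<] T) atTop ∧ Tendsto c (𝓝[>] T) atBot))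

end Breather

end

open Set Filter Topology
open scoped BoundedContinuousFunction

noncomputable section

namespace Breather

/-! ### The Banach spaces of smooth functions -/

/-! Every `V ∈ U` is anharmonic at `f V`, so `𝒟` is the zero set in `U` of the `C^1` function `g V =
cosMoment T (f V)`. If `g` has no critical points, the inverse function theorem straightens `𝒟`, and
its complement is dense.

Write `q = f V` and fix `W`. Differentiating Newton's equation shows that `h = Df(V) W` solves `h''
+ V''(q) h + W'(q) = 0`, and by anharmonicity it is the only even `T`-periodic solution. It is
easier to prescribe `h = ψ(q)` and to look for `W`: since `q'^2 = E - 2 V(q)`, the equation becomes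
one in the variable `x = q`, solved explicitly in `exists_localized_profile` with `ψ ≥ 0` supported
near a value `q t₀`. If `q t = q t₀`, then `t - t₀` or `t + t₀` is a period of `q`. Provided that
every period of `q` is a period of the cosine, `cos t = cos t₀ ≠ 0` on this level set, so `cos` has
one sign on the support of `h` and the moment of `h` is not zero (`exists_cosMoment_ne_zero`).

The proviso is where the components of `U` enter. The periods of `f V` are the multiples of some `T
/ m`. Having the period `T / m` is a locally constant property along `f`, since critical points of
nonconstant motions are nondegenerate. It therefore passes to the potential in the same component
with resonant minimal period, and that period divides `T / m`.

For the sign change, `χ₁(0) sin(τ/2) = ∫₀^{τ/2} cos(τ/2 - s) x_τ(s) ds`. At `τ = T` the right side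
is half the cosine moment up to sign, hence not zero off `𝒟`, while `sin(τ/2)` has a simple zero
there. -/

theorem Cb.norm_eq_norm_jet {n : ℕ} (f : Cb n) : ‖f‖ = ‖Cb.jet n f‖ := rfl

theorem Cb.isometry_jet (n : ℕ) : Isometry (Cb.jet n) :=
  AddMonoidHomClass.isometry_of_norm (Cb.jet n) fun f => (Cb.norm_eq_norm_jet f).symm

theorem Cb.abs_iteratedDeriv_le {n k : ℕ} (hk : k ≤ n) (f : Cb n) (t : ℝ) :
    |iteratedDeriv k f t| ≤ ‖f‖ := by
  have h1 := (Cb.jet n f ⟨k, Nat.lt_succ_of_le hk⟩).norm_coe_le_norm t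
  exact h1.trans (norm_le_pi_norm (Cb.jet n f) ⟨k, Nat.lt_succ_of_le hk⟩)

/-- Evaluation of the `k`-th derivative at a point. -/
def Cb.evalDeriv (n k : ℕ) (hk : k ≤ n) (t : ℝ) : Cb n →L[ℝ] ℝ :=
  LinearMap.mkContinuous
    { toFun := fun f => iteratedDeriv k f t
      map_add' := fun f g => by
        have hk' : (k : WithTop ℕ∞) ≤ n := by exact_mod_cast hk
        exact iteratedDeriv_add (f.2.1.of_le hk').contDiffAt (g.2.1.of_le hk').contDiffAt
      map_smul' := fun c f => by
        have hk' : (k : WithTop ℕ∞) ≤ n := by exact_mod_cast hk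
        exact iteratedDeriv_const_smul (f.2.1.of_le hk').contDiffAt c }
    1 fun f => by
      rw [one_mul]
      exact Cb.abs_iteratedDeriv_le hk f t

theorem Cb.evalDeriv_apply {n k : ℕ} (hk : k ≤ n) (t : ℝ) (f : Cb n) :
    Cb.evalDeriv n k hk t f = iteratedDeriv k f t := rfl

/-- Uniform convergence of all derivatives up to order `n` passes to the limit under
differentiation. Completeness is needed for the inverse function theorem on `Potential`. -/
instance (n : ℕ) : CompleteSpace (Cb n) := by
  refine Metric.complete_of_cauchySeq_tendsto fun u hu => ?_
  obtain ⟨G, hG⟩ := cauchySeq_tendsto_of_complete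
    ((Cb.isometry_jet n).uniformContinuous.comp_cauchySeq hu)
  have hu' (k : Fin (n + 1)) :
      TendstoUniformly (fun i => iteratedDeriv k (u i)) (G k) atTop :=
    BoundedContinuousFunction.tendsto_iff_tendstoUniformly.1 (tendsto_pi_nhds.1 hG k)
  have hG' (k : ℕ) (hk : k ≤ n) :
      iteratedDeriv k (G 0) = G ⟨k, Nat.lt_succ_of_le hk⟩ ∧
      ∀ hk' : k < n, ∀ t, HasDerivAt (G ⟨k, Nat.lt_succ_of_le hk⟩)
        (G ⟨k + 1, Nat.succ_lt_succ hk'⟩ t) t := by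
    have hd (k : ℕ) (hk : k ≤ n) (hk' : k < n) (t : ℝ) :
        HasDerivAt (G ⟨k, Nat.lt_succ_of_le hk⟩) (G ⟨k + 1, Nat.succ_lt_succ hk'⟩ t) t := by
      refine hasDerivAt_of_tendstoUniformly (hu' ⟨k + 1, Nat.succ_lt_succ hk'⟩)
        (Eventually.of_forall fun i x => ?_)
        (fun x => (hu' ⟨k, Nat.lt_succ_of_le hk⟩).tendsto_at x) t
      have h := ((u i).2.1.differentiable_iteratedDeriv k (by exact_mod_cast hk') x).hasDerivAt
      rwa [← iteratedDeriv_succ] at h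
    refine ⟨?_, hd k hk⟩
    induction k with
    | zero => simp
    | succ k ih =>
      rw [iteratedDeriv_succ, ih (Nat.le_of_succ_le hk)]
      exact funext fun t => (hd k (Nat.le_of_succ_le hk) hk t).deriv
  have hg : (G 0 : ℝ → ℝ) ∈ boundedContDiff n := by
    constructor
    · refine (contDiff_iff_iteratedDeriv (n := n)).2 ⟨fun m hm => ?_, fun m hm => ?_⟩
      · have hm : m ≤ n := by exact_mod_cast hm
        rw [(hG' m hm).1]
        exact (G _).continuous
      · have hm : m < n := by exact_mod_cast hm
        rw [(hG' m hm.le).1]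
        exact fun t => ((hG' m hm.le).2 hm t).differentiableAt
    · intro k hk
      rw [(hG' k hk).1]
      exact ⟨_, (G _).norm_coe_le_norm⟩
  refine ⟨⟨G 0, hg⟩, (Cb.isometry_jet n).isEmbedding.tendsto_nhds_iff.2 ?_⟩
  have hjet : Cb.jet n ⟨G 0, hg⟩ = G := by
    funext k
    ext t
    exact congrFun (hG' k (Nat.lt_succ_iff.1 k.2)).1 t
  rwa [hjet]

/-! ### Regular zero sets are submanifolds -/

/-- The zero set of a `C^1` function without critical zeros is a submanifold of codimension `1`. -/
theorem isSubmanifoldOfCodim_one_of_regular {E : Type*} [NormedAddCommGroup E] [NormedSpace ℝ E]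
    [CompleteSpace E] {U : Set E} (hU : IsOpen U) {g : E → ℝ} (hg : ContDiffOn ℝ 1 g U)
    (hreg : ∀ p ∈ U, g p = 0 → fderiv ℝ g p ≠ 0) :
    IsSubmanifoldOfCodim 1 U {p ∈ U | g p = 0} := by
  refine ⟨fun p hp => hp.1, fun p hp => ?_⟩
  obtain ⟨hpU, hp0⟩ := hp
  set ℓ := fderiv ℝ g p
  obtain ⟨w, hw⟩ : ∃ w, ℓ w = 1 := by
    obtain ⟨v, hv⟩ : ∃ v, ℓ v ≠ 0 := by
      by_contra! h
      exact hreg p hpU hp0 (ContinuousLinearMap.ext h)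
    exact ⟨(ℓ v)⁻¹ • v, by simp [hv]⟩
  have hgat (x : E) (hx : x ∈ U) : ContDiffAt ℝ 1 g x := hg.contDiffAt (hU.mem_nhds hx)
  -- The correction along `w` gives `ℓ (φ x) = g x`, because `ℓ w = 1`; it is of first order zero at
  -- `p`, so `φ` has derivative the identity there.
  let φ : E → E := fun x => (x - p) + (g x - ℓ (x - p)) • w
  have hφ (x : E) (hx : x ∈ U) : ContDiffAt ℝ 1 φ x := by
    have h1 : ContDiffAt ℝ 1 (fun x : E => x - p) x := contDiffAt_id.sub contDiffAt_const
    exact h1.add (((hgat x hx).sub (ℓ.contDiff.contDiffAt.comp x h1)).smul contDiffAt_const)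
  have hℓφ (x : E) : ℓ (φ x) = g x := by simp [φ, hw]
  have hφ' : HasFDerivAt φ ((ContinuousLinearEquiv.refl ℝ E : E ≃L[ℝ] E) : E →L[ℝ] E) p := by
    have h1 : HasFDerivAt (fun x : E => x - p) (ContinuousLinearMap.id ℝ E) p :=
      (hasFDerivAt_id p).sub_const p
    have h2 : HasFDerivAt g ℓ p := ((hgat p hpU).differentiableAt one_ne_zero).hasFDerivAt
    have h3 := h1.add ((h2.sub (ℓ.hasFDerivAt.comp p h1)).smul_const w)
    have h4 : ((ContinuousLinearEquiv.refl ℝ E : E ≃L[ℝ] E) : E →L[ℝ] E) =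
        ContinuousLinearMap.id ℝ E +
          (ℓ - ℓ ∘SL ContinuousLinearMap.id ℝ E).smulRight w := by
      ext x
      simp
    rw [h4]
    exact h3
  let e := (hφ p hpU).toOpenPartialHomeomorph φ hφ' one_ne_zero
  have hpe : p ∈ e.source := (hφ p hpU).mem_toOpenPartialHomeomorph_source hφ' one_ne_zero
  have heφ : (e : E → E) = φ := rfl
  have hsymm : ContDiffAt ℝ 1 e.symm (φ p) := (hφ p hpU).to_localInverse hφ' one_ne_zero
  -- The local inverse is `C^1` at `φ p`, hence on a neighbourhood `O`, to which the target is cut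
  -- down.
  obtain ⟨O, hO, hOo, hpO⟩ := mem_nhds_iff.1 (hsymm.eventually (by simp))
  refine ⟨((e.symm.restrOpen O hOo).symm).restrOpen U hU, ℓ.ker, ?_, ?_, ?_, ?_, ?_, ?_, ?_⟩
  · exact ⟨⟨hpe, hpO⟩, hpU⟩
  · exact fun x hx => hx.2
  · exact fun x hx => (hφ x hx.2).contDiffWithinAt
  · intro x hx
    refine ContDiffAt.contDiffWithinAt (hO ?_)
    exact hx.1.2
  · exact ℓ.isClosed_ker
  · have hsurj : Function.Surjective ℓ.toLinearMap := fun c => ⟨c • w, by simp [hw]⟩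
    have h := (LinearMap.quotKerEquivOfSurjective _ hsurj).finrank_eq
    rw [Module.finrank_self] at h
    simpa using Module.rank_eq_one_iff_finrank_eq_one.2 h
  · intro x hx
    change x ∈ U ∧ g x = 0 ↔ ℓ (φ x) = 0
    rw [hℓφ]
    exact ⟨fun h => h.2, fun h => ⟨hx.2, h⟩⟩

/-- A zero at which the derivative does not vanish is a limit of points that are not zeros. -/
theorem subset_closure_ne_zero_of_regular {E : Type*} [NormedAddCommGroup E] [NormedSpace ℝ E]
    {U : Set E} (hU : IsOpen U) {g : E → ℝ}
    (hreg : ∀ p ∈ U, g p = 0 → fderiv ℝ g p ≠ 0) :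
    U ⊆ closure {p ∈ U | g p ≠ 0} := by
  intro p hp
  by_contra hcl
  rw [mem_closure_iff_frequently, not_frequently] at hcl
  have h0 : g =ᶠ[𝓝 p] fun _ => 0 := by
    filter_upwards [hcl, hU.mem_nhds hp] with x hx hxU
    by_contra h
    exact hx ⟨hxU, h⟩
  refine hreg p hp h0.self_of_nhds ?_
  rw [h0.fderiv_eq]
  simp

/-! ### Motions in a potential -/

theorem Cb.differentiable {n : ℕ} (hn : n ≠ 0) (f : Cb n) : Differentiable ℝ f :=
  f.2.1.differentiable (by exact_mod_cast hn)

theorem Cb.hasDerivAt_deriv (f : Cb 2) (t : ℝ) :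
    HasDerivAt (deriv f) (iteratedDeriv 2 f t) t := by
  have h := (f.2.1.differentiable_iteratedDeriv 1 (by norm_num) t).hasDerivAt
  rwa [← iteratedDeriv_succ, iteratedDeriv_one] at h

theorem Cb.abs_apply_le {n : ℕ} (f : Cb n) (t : ℝ) : |f t| ≤ ‖f‖ := by
  simpa using Cb.abs_iteratedDeriv_le (Nat.zero_le n) f t

theorem Potential.lipschitzWith_deriv (V : Potential) : LipschitzWith ‖V‖₊ (deriv V) := by
  refine lipschitzWith_of_nnnorm_deriv_le (fun t => (Cb.hasDerivAt_deriv V t).differentiableAt)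
    fun t => ?_
  rw [(Cb.hasDerivAt_deriv V t).deriv]
  exact Cb.abs_iteratedDeriv_le le_rfl V t

/-- `x` solves Newton's equation `x'' + V'(x) = 0`. -/
structure IsMotion (V : Potential) (x : ℝ → ℝ) : Prop where
  differentiable : Differentiable ℝ x
  hasDerivAt_deriv : ∀ t, HasDerivAt (deriv x) (-deriv V (x t)) t

namespace IsMotion

variable {V : Potential} {x y : ℝ → ℝ}

/-- Uniqueness for the initial value problem: since `V''` is bounded, the vector field is globally
Lipschitz. -/
theorem eq_of_eq_at (hx : IsMotion V x) (hy : IsMotion V y) {t₀ : ℝ} (h : x t₀ = y t₀)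
    (h' : deriv x t₀ = deriv y t₀) : x = y := by
  let v : ℝ → ℝ × ℝ → ℝ × ℝ := fun _ p => (p.2, -deriv V p.1)
  have hv : LipschitzWith (max 1 (‖V‖₊ * 1)) (v 0) :=
    LipschitzWith.prod_snd.prodMk (V.lipschitzWith_deriv.comp LipschitzWith.prod_fst).neg
  have key := ODE_solution_unique_univ (v := v) (s := fun _ => univ) (t₀ := t₀)
    (f := fun t => (x t, deriv x t)) (g := fun t => (y t, deriv y t))
    (fun _ => hv.lipschitzOnWith)
    (fun t => ⟨(hx.differentiable t).hasDerivAt.prodMk (hx.hasDerivAt_deriv t), mem_univ _⟩)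
    (fun t => ⟨(hy.differentiable t).hasDerivAt.prodMk (hy.hasDerivAt_deriv t), mem_univ _⟩)
    (Prod.ext h h')
  exact funext fun t => congrArg Prod.fst (congrFun key t)

theorem comp_add_const (hx : IsMotion V x) (a : ℝ) : IsMotion V fun t => x (t + a) := by
  refine ⟨hx.differentiable.comp (differentiable_id.add_const a), fun t => ?_⟩
  have h : deriv (fun t => x (t + a)) = fun t => deriv x (t + a) :=
    funext fun t => deriv_comp_add_const x a t
  rw [h]
  exact (hx.hasDerivAt_deriv (t + a)).comp_add_const t a

theorem comp_const_sub (hx : IsMotion V x) (a : ℝ) : IsMotion V fun t => x (a - t) := by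
  refine ⟨hx.differentiable.comp (differentiable_id.const_sub a), fun t => ?_⟩
  have h : deriv (fun t => x (a - t)) = fun t => -deriv x (a - t) :=
    funext fun t => deriv_comp_const_sub x a t
  rw [h]
  exact (((hx.hasDerivAt_deriv (a - t)).comp_const_sub a t).neg).congr_deriv (neg_neg _)

theorem const {c : ℝ} (hc : deriv V c = 0) : IsMotion V fun _ => c := by
  refine ⟨differentiable_const c, fun t => ?_⟩
  simp only [deriv_const', hc, neg_zero]
  exact hasDerivAt_const t 0

theorem eq_const (hx : IsMotion V x) {t : ℝ} (ht : deriv x t = 0) (hV : deriv V (x t) = 0) :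
    x = fun _ => x t :=
  hx.eq_of_eq_at (IsMotion.const hV) rfl (by simpa using ht)

/-- Conservation of energy. -/
theorem energy (hx : IsMotion V x) (t s : ℝ) :
    deriv x t ^ 2 + 2 * V (x t) = deriv x s ^ 2 + 2 * V (x s) := by
  have hd (t : ℝ) : HasDerivAt (fun t => deriv x t ^ 2 + 2 * V (x t)) 0 t := by
    have h1 := (hx.hasDerivAt_deriv t).pow 2
    have h2 := ((Cb.differentiable two_ne_zero V (x t)).hasDerivAt.comp t
      (hx.differentiable t).hasDerivAt).const_mul 2
    refine (h1.add h2).congr_deriv ?_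
    simp
    ring
  exact is_const_of_deriv_eq_zero (fun t => (hd t).differentiableAt) (fun t => (hd t).deriv) t s

theorem deriv_neg_of_even (hx : Function.Even x) (t : ℝ) : deriv x (-t) = -deriv x t := by
  have h := deriv_comp_neg x (-t)
  rw [neg_neg, funext hx] at h
  exact h

/-- A motion is symmetric about each of its critical times; composing the reflections about `t` and
`0` gives the translation by `2 * t`. -/
theorem periodic_of_deriv_eq_zero (hx : IsMotion V x) (he : Function.Even x) {t : ℝ}
    (ht : deriv x t = 0) : Function.Periodic x (2 * t) := by
  have h := hx.eq_of_eq_at (hx.comp_const_sub (2 * t)) (t₀ := t) (congrArg x (by ring))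
    (by rw [deriv_comp_const_sub, show 2 * t - t = t by ring, ht, neg_zero])
  intro s
  have h1 := congrFun h (-s)
  rw [he s] at h1
  rw [h1]
  exact congrArg x (by ring)

theorem _root_.Function.Periodic.deriv {x : ℝ → ℝ} {p : ℝ} (h : Function.Periodic x p) :
    Function.Periodic (deriv x) p := by
  intro t
  rw [← deriv_comp_add_const x p t, funext h]

theorem deriv_eq_zero_of_periodic (he : Function.Even x) {t : ℝ}
    (h : Function.Periodic x (2 * t)) : deriv x t = 0 := by
  have h1 := h.deriv (-t)
  rw [deriv_neg_of_even he, show -t + 2 * t = t by ring] at h1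
  linarith

/-- By conservation of energy the velocities at `t` and `s` agree up to sign, so `x` equals a
translate or a reflection of itself; evenness turns the reflection into a translation. -/
theorem periodic_sub_or_add_of_eq (hx : IsMotion V x) (he : Function.Even x) {t s : ℝ}
    (h : x t = x s) : Function.Periodic x (t - s) ∨ Function.Periodic x (t + s) := by
  have h2 : deriv x t ^ 2 = deriv x s ^ 2 := by
    have := hx.energy t s
    rw [h] at this
    linarith
  rcases sq_eq_sq_iff_eq_or_eq_neg.1 h2 with h3 | h3
  · left
    have key := hx.eq_of_eq_at (hx.comp_add_const (t - s)) (t₀ := s)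
      (by rw [← h]; exact congrArg x (by ring))
      (by rw [deriv_comp_add_const, ← h3]; exact congrArg (_root_.deriv x) (by ring))
    exact fun r => (congrFun key r).symm
  · right
    have key := hx.eq_of_eq_at (hx.comp_const_sub (t + s)) (t₀ := s)
      (by rw [← h]; exact congrArg x (by ring))
      (by rw [deriv_comp_const_sub, show t + s - s = t by ring, h3, neg_neg])
    intro r
    have h1 := congrFun key (-r)
    rw [he r] at h1
    rw [h1]
    exact congrArg x (by ring)

end IsMotion

/-- The group of periods of a function. -/
def periods (x : ℝ → ℝ) : AddSubgroup ℝ where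
  carrier := {p | Function.Periodic x p}
  zero_mem' := fun t => by rw [add_zero]
  add_mem' := fun ha hb => ha.add_period hb
  neg_mem' := fun ha => ha.neg

theorem mem_periods {x : ℝ → ℝ} {p : ℝ} : p ∈ periods x ↔ Function.Periodic x p := Iff.rfl

/-- The periods of a nonconstant continuous `T`-periodic function are the multiples of `T / m`
for some positive integer `m`. -/
theorem exists_periods_eq_closure {x : ℝ → ℝ} (hx : Continuous x)
    (hnc : ¬ ∃ c : ℝ, ∀ t, x t = c) {T : ℝ} (hT : 0 < T) (hxT : Function.Periodic x T) :
    ∃ m : ℕ, 0 < m ∧ periods x = AddSubgroup.closure {T / m} := by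
  rcases AddSubgroup.dense_or_cyclic (periods x) with h | ⟨a, ha⟩
  · refine absurd ⟨x 0, fun t => ?_⟩ hnc
    have hcl : IsClosed {p : ℝ | x p = x 0} := isClosed_eq hx continuous_const
    have h1 : closure (periods x : Set ℝ) ⊆ {p : ℝ | x p = x 0} := by
      refine hcl.closure_subset_iff.2 fun p hp => ?_
      have := (mem_periods.1 hp) 0
      rwa [zero_add] at this
    exact h1 (h t)
  · have hTm : T ∈ periods x := hxT
    rw [ha, AddSubgroup.mem_closure_singleton] at hTm
    obtain ⟨m, hm⟩ := hTm
    have hm0 : m ≠ 0 := by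
      rintro rfl
      simp at hm
      exact hT.ne hm
    have hma : (m : ℝ) * a = T := by simpa using hm
    refine ⟨m.natAbs, Int.natAbs_pos.2 hm0, ?_⟩
    rw [ha, Nat.cast_natAbs, Int.cast_abs, ← hma]
    have hmr : (m : ℝ) ≠ 0 := by exact_mod_cast hm0
    -- The generator `a` may be negative; then `T / |m| = -a` generates the same group.
    rcases abs_choice (m : ℝ) with h | h
    · rw [h, mul_div_cancel_left₀ _ hmr]
    · rw [h, div_neg, mul_div_cancel_left₀ _ hmr, ← AddSubgroup.closure_neg]
      simp

theorem isMotion_of_newton_eq_zero {T : ℝ} {V : Potential} {q : EvenPeriodic T 2}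
    (h : newton q V = 0) : IsMotion V q := by
  refine ⟨Cb.differentiable two_ne_zero q.1, fun t => ?_⟩
  have h1 : iteratedDeriv 2 q t + deriv V (q t) = 0 :=
    congrArg (fun r : EvenPeriodic T 0 => r t) h
  rw [← eq_neg_of_add_eq_zero_left h1]
  exact Cb.hasDerivAt_deriv q.1 t

/-! ### Persistence of periods -/

/-- The remainder of `s` modulo `p` is a period smaller than `p`, hence zero, so `s` is an integer
multiple of `p`. -/
theorem IsMinimalPeriod.periodic_of_periodic {x y : ℝ → ℝ} {p s : ℝ} (hp : IsMinimalPeriod x p)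
    (hs : Function.Periodic x s) (hy : Function.Periodic y p) : Function.Periodic y s := by
  obtain ⟨hp0, hpx, hmin⟩ := hp
  have hmem := toIcoMod_mem_Ico hp0 0 s
  have hper : Function.Periodic x (toIcoMod hp0 0 s) :=
    (periods x).sub_mem hs ((periods x).zsmul_mem hpx _)
  have h0 : toIcoMod hp0 0 s = 0 := by
    by_contra h
    refine hmin _ (lt_of_le_of_ne hmem.1 (Ne.symm h)) ?_ hper
    simpa using hmem.2
  have hs' : s = toIcoDiv hp0 0 s • p := by
    rw [toIcoMod, sub_eq_zero] at h0
    exact h0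
  rw [hs']
  exact (periods y).zsmul_mem hy _

theorem IsResonant.periodic_cos {p : ℝ} (h : IsResonant p) : Function.Periodic Real.cos p := by
  obtain ⟨n, -, rfl⟩ := h
  have := (periods Real.cos).nsmul_mem Real.cos_periodic n
  rwa [nsmul_eq_mul, mul_comm] at this

theorem IsResonant.pos {p : ℝ} (h : IsResonant p) : 0 < p := by
  obtain ⟨n, hn, rfl⟩ := h
  have : (0 : ℝ) < n := by exact_mod_cast hn
  positivity

/-- Critical points of a nonconstant motion are nondegenerate: zero velocity at an equilibrium
position would force the constant solution. -/
theorem IsMotion.deriv_deriv_ne_zero {V : Potential} {x : ℝ → ℝ} (hx : IsMotion V x)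
    (hnc : ¬ ∃ c : ℝ, ∀ t, x t = c) {t : ℝ} (ht : deriv x t = 0) : deriv V (x t) ≠ 0 :=
  fun h => hnc ⟨x t, fun s => congrFun (hx.eq_const ht h) s⟩

/-- The period `T / m` of a nonconstant motion persists under small perturbations among even
`T`-periodic motions. -/
theorem exists_periodic_of_norm_sub_lt {T : ℝ} {V : Potential} {q : EvenPeriodic T 2}
    (hq : IsMotion V q) (hnc : ¬ ∃ c : ℝ, ∀ t, q t = c) {m : ℕ} (hm : 0 < m)
    (hqm : Function.Periodic q (T / m)) :
    ∃ ε > 0, ∀ (W : Potential) (r : EvenPeriodic T 2), IsMotion W r → ‖r - q‖ < ε →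
      Function.Periodic r (T / m) := by
  have hm' : (0 : ℝ) < m := by exact_mod_cast hm
  set τ := T / m with hτ
  have hmτ : m * τ = T := by rw [hτ]; field_simp
  have hd2 (r : EvenPeriodic T 2) (t : ℝ) :
      |iteratedDeriv 2 r t - iteratedDeriv 2 q t| ≤ ‖r - q‖ := by
    have h := Cb.abs_iteratedDeriv_le le_rfl (r - q).1 t
    rwa [← Cb.evalDeriv_apply le_rfl, AddSubgroupClass.coe_sub, map_sub] at h
  have hd1 (r : EvenPeriodic T 2) (t : ℝ) : |deriv r t - deriv q t| ≤ ‖r - q‖ := by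
    have h := Cb.abs_iteratedDeriv_le one_le_two (r - q).1 t
    rw [← Cb.evalDeriv_apply one_le_two, AddSubgroupClass.coe_sub, map_sub] at h
    rwa [Cb.evalDeriv_apply, Cb.evalDeriv_apply, iteratedDeriv_one, iteratedDeriv_one] at h
  have hodd (r : EvenPeriodic T 2) : deriv r 0 = 0 := by
    have := IsMotion.deriv_neg_of_even r.2.2 0
    rw [neg_zero] at this
    linarith
  have hsecond (t : ℝ) : iteratedDeriv 2 q t = -deriv V (q t) :=
    (Cb.hasDerivAt_deriv q.1 t).unique (hq.hasDerivAt_deriv t)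
  set c := iteratedDeriv 2 q 0 with hc
  have hc0 : c ≠ 0 := by
    rw [hc, hsecond, neg_ne_zero]
    exact hq.deriv_deriv_ne_zero hnc (hodd q)
  -- On `(-η, η)` the second derivative of `q` stays within `|c| / 2` of `c`, so that of a nearby
  -- `r` has no zero and `0` is the only critical point of `r` there.
  obtain ⟨η, hη, hηq⟩ := Metric.continuous_iff.1
    (q.1.2.1.continuous_iteratedDeriv 2 le_rfl) 0 (|c| / 2) (by positivity)
  have hhalf : deriv q (τ / 2) = 0 :=
    IsMotion.deriv_eq_zero_of_periodic q.2.2 (by rwa [mul_div_cancel₀ _ two_ne_zero])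
  -- The derivative of `q` takes opposite nonzero values at `b` and `τ - b`, which forces a critical
  -- point `t` of a nearby `r` in between. The bound `η / m` ensures `m * |τ / 2 - t| < η`.
  obtain ⟨b, hb0, hb1, hb2⟩ : ∃ b, deriv q b ≠ 0 ∧ τ / 2 < b ∧ b < τ / 2 + η / m := by
    have h1 : ∀ᶠ z in 𝓝[>] (τ / 2), deriv q z ≠ 0 :=
      ((hq.hasDerivAt_deriv (τ / 2)).eventually_ne
        (neg_ne_zero.2 (hq.deriv_deriv_ne_zero hnc hhalf))).filter_mono
          (nhdsWithin_mono _ fun z hz => ne_of_gt hz)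
    have h2 : ∀ᶠ z in 𝓝[>] (τ / 2), z ∈ Ioo (τ / 2) (τ / 2 + η / m) :=
      Ioo_mem_nhdsGT (by linarith [div_pos hη hm'])
    obtain ⟨b, hb, hb'⟩ := (h1.and h2).exists
    exact ⟨b, hb, hb'⟩
  have hqa : deriv q (τ - b) = -deriv q b := by
    rw [← IsMotion.deriv_neg_of_even q.2.2, ← hqm.deriv (-b)]
    exact congrArg (deriv q) (by ring)
  refine ⟨min (|c| / 2) (|deriv q b|), by positivity, fun W r hr hrq => ?_⟩
  obtain ⟨hr1, hr2⟩ := lt_min_iff.1 hrq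
  have hsmall (t : ℝ) (ht : |t| < η) (hrt : deriv r t = 0) : t = 0 := by
    have hpos (t : ℝ) (ht0 : 0 < t) (ht : t < η) : deriv r t ≠ 0 := by
      intro hrt
      obtain ⟨s, hs, hs0⟩ := exists_hasDerivAt_eq_zero ht0
        (HasDerivAt.continuousOn fun s _ => Cb.hasDerivAt_deriv r.1 s) ((hodd r).trans hrt.symm)
        fun s _ => Cb.hasDerivAt_deriv r.1 s
      have h1 := hηq s (by rw [Real.dist_eq, sub_zero, abs_of_pos hs.1]; exact hs.2.trans ht)
      have h2 := (hd2 r s).trans_lt hr1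
      rw [hs0, zero_sub, abs_neg] at h2
      rw [Real.dist_eq] at h1
      have h3 := abs_sub_abs_le_abs_sub c (iteratedDeriv 2 q s)
      rw [abs_sub_comm] at h3
      linarith
    rcases lt_trichotomy t 0 with h | h | h
    · refine absurd ?_ (hpos (-t) (by linarith) (by rwa [abs_of_neg h] at ht))
      rw [IsMotion.deriv_neg_of_even r.2.2, hrt, neg_zero]
    · exact h
    · exact absurd hrt (hpos t h (by rwa [abs_of_pos h] at ht))
  have hrb := (hd1 r b).trans_lt hr2
  have hra := (hd1 r (τ - b)).trans_lt hr2
  rw [hqa, sub_neg_eq_add] at hra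
  have hzero : (0 : ℝ) ∈ uIcc (deriv r (τ - b)) (deriv r b) := by
    rw [abs_lt] at hra hrb
    rw [mem_uIcc]
    rcases lt_or_gt_of_ne hb0 with h | h
    · rw [abs_of_neg h] at hra hrb
      right; constructor <;> linarith
    · rw [abs_of_pos h] at hra hrb
      left; constructor <;> linarith
  obtain ⟨t, ht, ht0⟩ := intermediate_value_uIcc
    (HasDerivAt.continuousOn fun s _ => Cb.hasDerivAt_deriv r.1 s) hzero
  rw [uIcc_of_le (by linarith)] at ht
  have hper := hr.periodic_of_deriv_eq_zero r.2.2 ht0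
  -- Both `T` and `m * (2 * t)` are periods of `r`. Half of their difference is a critical point
  -- within `η` of `0`, hence `0`, which gives `2 * t = τ` exactly.
  have hper' : Function.Periodic r (2 * (m * (τ / 2 - t))) := by
    have := (periods r).sub_mem r.2.1 ((periods r).nsmul_mem hper m)
    have h2 : 2 * (m * (τ / 2 - t)) = T - m • (2 * t) := by
      rw [nsmul_eq_mul]
      linear_combination hmτ
    rwa [h2]
  have h0 := hsmall _ (by
    rw [abs_mul, abs_of_pos hm', mul_comm, ← lt_div_iff₀ hm', abs_lt]
    constructor <;> linarith [ht.1, ht.2]) (IsMotion.deriv_eq_zero_of_periodic r.2.2 hper')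
  have h1 : τ / 2 - t = 0 := (mul_eq_zero.1 h0).resolve_left hm'.ne'
  rwa [show τ = 2 * t by linarith]

/-- Failure of periodicity at a single time also survives uniformly small perturbations, so the
property is locally constant. -/
theorem exists_periodic_iff_of_norm_sub_lt {T : ℝ} {V : Potential} {q : EvenPeriodic T 2}
    (hq : IsMotion V q) (hnc : ¬ ∃ c : ℝ, ∀ t, q t = c) {m : ℕ} (hm : 0 < m) :
    ∃ ε > 0, ∀ (W : Potential) (r : EvenPeriodic T 2), IsMotion W r → ‖r - q‖ < ε →
      (Function.Periodic r (T / m) ↔ Function.Periodic q (T / m)) := by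
  by_cases h : Function.Periodic q (T / m)
  · obtain ⟨ε, hε, H⟩ := exists_periodic_of_norm_sub_lt hq hnc hm h
    exact ⟨ε, hε, fun W r hr hrq => iff_of_true (H W r hr hrq) h⟩
  · obtain ⟨t, ht⟩ := not_forall.1 h
    have ht' : 0 < |q (t + T / m) - q t| := abs_pos.2 (sub_ne_zero.2 ht)
    refine ⟨_, half_pos ht', fun W r hr hrq => iff_of_false (fun hp => ?_) h⟩
    have hd (s : ℝ) : |r s - q s| ≤ ‖r - q‖ := Cb.abs_apply_le (r - q).1 s
    have h1 := hd (t + T / m)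
    have h2 := hd t
    rw [hp t] at h1
    have h3 := abs_sub_le (q (t + T / m)) (r t) (q t)
    rw [abs_sub_comm] at h1
    linarith

/-- If every component of `U` contains a potential for which the minimal period is resonant, then
all the periods of all the motions `f V` are periods of the cosine. -/
theorem IsPerturbationNhd.periodic_cos {T : ℝ} (hT : 0 < T) {U : Set Potential}
    {f : Potential → EvenPeriodic T 2} {q₀ : EvenPeriodic T 2} {V₀ : Potential}
    (hU : IsPerturbationNhd U f q₀ V₀)
    (hper : ∀ V ∈ U, ∃ W ∈ connectedComponentIn U V, ∃ p : ℝ,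
      IsMinimalPeriod (f W) p ∧ IsResonant p)
    {V : Potential} (hV : V ∈ U) {s : ℝ} (hs : Function.Periodic (f V) s) :
    Function.Periodic Real.cos s := by
  classical
  obtain ⟨-, -, hf, han, -⟩ := hU
  have hmot (W : Potential) (hW : W ∈ U) : IsMotion W (f W) :=
    isMotion_of_newton_eq_zero (han W hW).2.1
  obtain ⟨m, hm, hcl⟩ := exists_periods_eq_closure (f V).1.2.1.continuous (han V hV).1 hT (f V).2.1
  obtain ⟨W, hW, p, hp, hpr⟩ := hper V hV
  -- A locally constant map to the discrete space `Bool` is constant on the preconnected component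
  -- of `V`.
  have hcont : ContinuousOn (fun X => decide (Function.Periodic (f X) (T / m))) U := by
    intro X hX
    obtain ⟨ε, hε, H⟩ := exists_periodic_iff_of_norm_sub_lt (hmot X hX) (han X hX).1 hm
    refine (continuousWithinAt_const
      (b := decide (Function.Periodic (f X) (T / m)))).congr_of_eventuallyEq ?_ rfl
    filter_upwards [(hf.continuousOn X hX).eventually (Metric.ball_mem_nhds _ hε),
      self_mem_nhdsWithin] with Y hY hYU
    rw [decide_eq_decide]
    exact H Y (f Y) (hmot Y hYU) (by rwa [← dist_eq_norm])
  have hVm : T / m ∈ periods (f V) := by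
    rw [hcl]
    exact AddSubgroup.mem_closure_singleton_self _
  have heq := isPreconnected_connectedComponentIn.constant
    (hcont.mono (connectedComponentIn_subset U V)) (mem_connectedComponentIn hV) hW
  have hWm : Function.Periodic (f W) (T / m) := (decide_eq_decide.1 heq).1 hVm
  have hcos := hp.periodic_of_periodic hWm hpr.periodic_cos
  have hs' : s ∈ periods (f V) := hs
  rw [hcl] at hs'
  have hle : AddSubgroup.closure {T / m} ≤ periods Real.cos := by
    rw [AddSubgroup.closure_le, singleton_subset_iff]
    exact hcos
  exact hle hs'

/-! ### The first variation of the cosine moment -/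

/-- The first cosine moment `∫₀ᵀ cos t q(t) dt`. -/
def cosMoment (T : ℝ) : EvenPeriodic T 2 →L[ℝ] ℝ :=
  LinearMap.mkContinuous
    { toFun := fun q => ∫ t in (0 : ℝ)..T, Real.cos t * q t
      map_add' := fun p q => by
        refine Eq.trans (intervalIntegral.integral_congr fun t _ => mul_add _ _ _)
          (intervalIntegral.integral_add
            ((Real.continuous_cos.mul p.1.2.1.continuous).intervalIntegrable _ _)
            ((Real.continuous_cos.mul q.1.2.1.continuous).intervalIntegrable _ _))
      map_smul' := fun c q => by
        exact (intervalIntegral.integral_congr fun t _ => mul_left_comm _ _ _).trans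
          (intervalIntegral.integral_const_mul _ _) }
    |T| fun q => by
      have h := intervalIntegral.norm_integral_le_of_norm_le_const (a := 0) (b := T)
        (f := fun t => Real.cos t * q t) (C := ‖q‖) fun t _ => by
          rw [norm_mul]
          exact (mul_le_of_le_one_left (norm_nonneg _) (Real.abs_cos_le_one t)).trans
            (Cb.abs_apply_le q.1 t)
      rw [sub_zero, mul_comm] at h
      exact h

theorem cosMoment_apply {T : ℝ} (q : EvenPeriodic T 2) :
    cosMoment T q = ∫ t in (0 : ℝ)..T, Real.cos t * q t := rfl

/-- Evaluation of the `k`-th derivative of an even periodic function at a point. -/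
def EvenPeriodic.evalDeriv (T : ℝ) (n k : ℕ) (hk : k ≤ n) (t : ℝ) : EvenPeriodic T n →L[ℝ] ℝ :=
  (Cb.evalDeriv n k hk t).comp (EvenPeriodic T n).subtypeL

theorem EvenPeriodic.evalDeriv_apply {T : ℝ} {n k : ℕ} (hk : k ≤ n) (t : ℝ)
    (q : EvenPeriodic T n) : EvenPeriodic.evalDeriv T n k hk t q = iteratedDeriv k q t := rfl

theorem EvenPeriodic.evalDeriv_zero_apply {T : ℝ} {n : ℕ} (t : ℝ) (q : EvenPeriodic T n) :
    EvenPeriodic.evalDeriv T n 0 (Nat.zero_le n) t q = q t := by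
  rw [EvenPeriodic.evalDeriv_apply, iteratedDeriv_zero]

/-- The restriction to a point of Newton's equation along a curve of functions and a line of
potentials. -/
theorem hasDerivAt_newton_apply {T : ℝ} (V W : Potential) {γ : ℝ → EvenPeriodic T 2}
    {h : EvenPeriodic T 2} (hγ : HasDerivAt γ h 0) (t : ℝ) :
    HasDerivAt (fun s : ℝ => newton (γ s) (V + s • W) t)
      (iteratedDeriv 2 h t + iteratedDeriv 2 V (γ 0 t) * h t + deriv W (γ 0 t)) 0 := by
  have h0 : HasDerivAt (fun s => γ s t) (h t) 0 := by
    have := (EvenPeriodic.evalDeriv T 2 0 (Nat.zero_le 2) t).hasFDerivAt.comp_hasDerivAt 0 hγ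
    rw [EvenPeriodic.evalDeriv_zero_apply] at this
    exact this.congr_of_eventuallyEq (Eventually.of_forall fun s =>
      (EvenPeriodic.evalDeriv_zero_apply t (γ s)).symm)
  have h2 : HasDerivAt (fun s => iteratedDeriv 2 (γ s) t) (iteratedDeriv 2 h t) 0 :=
    (EvenPeriodic.evalDeriv T 2 2 le_rfl t).hasFDerivAt.comp_hasDerivAt 0 hγ
  have hV : HasDerivAt (fun s => deriv V (γ s t)) (iteratedDeriv 2 V (γ 0 t) * h t) 0 :=
    HasDerivAt.comp (0 : ℝ) (h := fun s => γ s t) (h₂ := deriv V)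
      (Cb.hasDerivAt_deriv V (γ 0 t)) h0
  have hW : HasDerivAt (fun s => deriv W (γ s t)) (iteratedDeriv 2 W (γ 0 t) * h t) 0 :=
    HasDerivAt.comp (0 : ℝ) (h := fun s => γ s t) (h₂ := deriv W)
      (Cb.hasDerivAt_deriv W (γ 0 t)) h0
  -- The factor `s` vanishes at `0`, so only `deriv W (γ 0 t)` survives from the last product.
  have key := (h2.add hV).add ((hasDerivAt_id (0 : ℝ)).mul hW)
  refine (key.congr_of_eventuallyEq (Eventually.of_forall fun s => ?_)).congr_deriv (by simp)
  have hd : deriv (V + s • W : Potential) (γ s t) = deriv V (γ s t) + s * deriv W (γ s t) := by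
    have := map_add (Cb.evalDeriv 2 1 one_le_two (γ s t)) V (s • W)
    rw [map_smul] at this
    simpa only [Cb.evalDeriv_apply, iteratedDeriv_one, smul_eq_mul] using this
  change iteratedDeriv 2 (γ s) t + deriv (V + s • W : Potential) (γ s t) =
    iteratedDeriv 2 (γ s) t + deriv V (γ s t) + s * deriv W (γ s t)
  rw [hd, add_assoc]

/-- The linearized equation along an anharmonic motion has no even periodic solutions. -/
theorem IsAnharmonic.eq_zero_of_linearized {T : ℝ} {V : Potential} {q : EvenPeriodic T 2}
    (hq : IsAnharmonic V q) {h : EvenPeriodic T 2}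
    (hh : ∀ t, iteratedDeriv 2 h t + iteratedDeriv 2 V (q t) * h t = 0) : h = 0 := by
  obtain ⟨hnc, -, hker⟩ := hq
  -- Where the map is not differentiable, `fderiv` is `0` by default; its kernel would contain `q`,
  -- which is nonzero because it is nonconstant.
  have hdiff : DifferentiableAt ℝ (fun p : EvenPeriodic T 2 => newton p V) q := by
    by_contra hnd
    rw [fderiv_zero_of_not_differentiableAt hnd] at hker
    have hq0 : q ∈ (0 : EvenPeriodic T 2 →L[ℝ] EvenPeriodic T 0).ker := by simp
    rw [hker, Submodule.mem_bot] at hq0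
    exact hnc ⟨0, fun t => by rw [hq0]; rfl⟩
  have hmem : h ∈ (fderiv ℝ (fun p : EvenPeriodic T 2 => newton p V) q).ker := by
    rw [LinearMap.mem_ker]
    apply Subtype.ext
    apply Subtype.ext
    funext t
    have hγ : HasDerivAt (fun s : ℝ => q + s • h) h 0 := by
      simpa using ((hasDerivAt_id (0 : ℝ)).smul_const h).const_add q
    have h1 := hasDerivAt_newton_apply V 0 hγ t
    have h2 : HasFDerivAt (fun p : EvenPeriodic T 2 => newton p V)
        (fderiv ℝ (fun p : EvenPeriodic T 2 => newton p V) q) (q + (0 : ℝ) • h) := by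
      rw [zero_smul, add_zero]
      exact hdiff.hasFDerivAt
    have h3 := (EvenPeriodic.evalDeriv T 0 0 le_rfl t).hasFDerivAt.comp_hasDerivAt (0 : ℝ)
      (h2.comp_hasDerivAt 0 hγ)
    have h4 : HasDerivAt (fun s : ℝ => newton (q + s • h) (V + s • (0 : Potential)) t)
        (EvenPeriodic.evalDeriv T 0 0 le_rfl t
          (fderiv ℝ (fun p : EvenPeriodic T 2 => newton p V) q h)) 0 := by
      refine h3.congr_of_eventuallyEq (Eventually.of_forall fun s => ?_)
      change newton (q + s • h) (V + s • (0 : Potential)) t =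
        EvenPeriodic.evalDeriv T 0 0 le_rfl t (newton (q + s • h) V)
      rw [EvenPeriodic.evalDeriv_zero_apply, smul_zero, add_zero]
    have h5 := h4.unique h1
    rw [EvenPeriodic.evalDeriv_zero_apply] at h5
    refine h5.trans ?_
    have h6 : deriv (0 : Potential) (q t) = 0 := deriv_const _ _
    simp only [zero_smul, add_zero, hh t, h6]
    rfl
  rw [hker] at hmem
  exact (Submodule.mem_bot ℝ).1 hmem

/-- The derivative of the motion with respect to the potential solves the linearized equation. -/
theorem IsPerturbationNhd.linearized {T : ℝ} {U : Set Potential}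
    {f : Potential → EvenPeriodic T 2} {q₀ : EvenPeriodic T 2} {V₀ : Potential}
    (hU : IsPerturbationNhd U f q₀ V₀) {V : Potential} (hV : V ∈ U) (W : Potential) (t : ℝ) :
    iteratedDeriv 2 (fderiv ℝ f V W) t + iteratedDeriv 2 V (f V t) * (fderiv ℝ f V W) t +
      deriv W (f V t) = 0 := by
  obtain ⟨hUo, -, hf, han, -⟩ := hU
  have hline : HasDerivAt (fun s : ℝ => V + s • W) W 0 := by
    simpa using ((hasDerivAt_id (0 : ℝ)).smul_const W).const_add V
  have hline0 : V + (0 : ℝ) • W = V := by rw [zero_smul, add_zero]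
  have hfd : HasFDerivAt f (fderiv ℝ f V) (V + (0 : ℝ) • W) := by
    rw [hline0]
    exact ((hf.contDiffAt (hUo.mem_nhds hV)).differentiableAt one_ne_zero).hasFDerivAt
  have hγ : HasDerivAt (fun s : ℝ => f (V + s • W)) (fderiv ℝ f V W) 0 :=
    hfd.comp_hasDerivAt 0 hline
  have h1 := hasDerivAt_newton_apply V W hγ t
  have h2 : (fun s : ℝ => newton (f (V + s • W)) (V + s • W) t) =ᶠ[𝓝 0] fun _ => 0 := by
    have hmem : ∀ᶠ s : ℝ in 𝓝 0, V + s • W ∈ U := by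
      refine hline.continuousAt.eventually_mem ?_
      rw [hline0]
      exact hUo.mem_nhds hV
    filter_upwards [hmem] with s hs
    rw [(han _ hs).2.1]
    rfl
  have h3 := h1.unique ((hasDerivAt_const (0 : ℝ) (0 : ℝ)).congr_of_eventuallyEq h2)
  simpa only [hline0] using h3

/-! ### Localized variations of the potential -/

theorem HasCompactSupport.iteratedDeriv {x : ℝ → ℝ} (hx : HasCompactSupport x) (k : ℕ) :
    HasCompactSupport (iteratedDeriv k x) := by
  induction k with
  | zero => simpa using hx
  | succ k ih =>
    rw [iteratedDeriv_succ]
    exact ih.deriv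

/-- A compactly supported smooth function as an element of `Cb n`. -/
def Cb.ofHasCompactSupport {n : ℕ} (x : ℝ → ℝ) (hx : ContDiff ℝ n x) (hs : HasCompactSupport x) :
    Cb n :=
  ⟨x, hx, fun k hk => (HasCompactSupport.iteratedDeriv hs k).exists_bound_of_continuous
    (hx.continuous_iteratedDeriv k (by exact_mod_cast hk))⟩

/-- A smooth even periodic function as an element of `EvenPeriodic T n`. -/
def EvenPeriodic.mk {T : ℝ} (hT : T ≠ 0) {n : ℕ} (x : ℝ → ℝ) (hx : ContDiff ℝ n x)
    (hp : Function.Periodic x T) (he : Function.Even x) : EvenPeriodic T n :=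
  ⟨⟨x, hx, fun k hk => by
    have hper : Function.Periodic (iteratedDeriv k x) T := fun t => by
      rw [← congrFun (iteratedDeriv_comp_add_const k x T) t, funext hp]
    have hb := hper.isBounded_of_continuous hT
      (hx.continuous_iteratedDeriv k (by exact_mod_cast hk))
    obtain ⟨C, hC⟩ := hb.exists_norm_le
    exact ⟨C, fun t => hC _ (mem_range_self t)⟩⟩, hp, he⟩

/-- At an energy level `E` above `V x₀` there is a potential, supported near `x₀`, for which the
linearized equation is solved by a bump function of the motion. -/
theorem exists_localized_profile (V : Potential) {E x₀ r : ℝ} (hE : 0 < E - 2 * V x₀)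
    (hr : 0 < r) :
    ∃ (ψ : ℝ → ℝ) (W : Potential), ContDiff ℝ 2 ψ ∧ (∀ x, 0 ≤ ψ x) ∧ 0 < ψ x₀ ∧
      (∀ x, ψ x ≠ 0 → |x - x₀| < r) ∧
      ∀ x, deriv (deriv ψ) x * (E - 2 * V x) - deriv ψ x * deriv V x +
        iteratedDeriv 2 V x * ψ x + deriv W x = 0 := by
  have hVc : Continuous V := V.2.1.continuous
  obtain ⟨ρ, hρ, hρE⟩ := Metric.eventually_nhds_iff.1
    ((continuous_const.sub (hVc.const_mul 2)).continuousAt.eventually (lt_mem_nhds hE))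
  set P : ℝ → ℝ := fun x => E - 2 * V x
  -- The outer radius is below `ρ`, so that `P` is positive around the support of `κ` and `√P` is
  -- smooth enough there, and below `r`, as the support condition demands.
  let κ : ContDiffBump x₀ := ⟨min ρ r / 4, min ρ r / 2, by positivity, by
    have : 0 < min ρ r := lt_min hρ hr
    linarith⟩
  have hout : κ.rOut = min ρ r / 2 := rfl
  have hmin : 0 < min ρ r := lt_min hρ hr
  have hκC (n : ℕ) : ContDiff ℝ n κ := κ.contDiff (n := n)
  have hκ1 (x : ℝ) : HasDerivAt κ (deriv κ x) x :=
    ((hκC 1).differentiable (by norm_num) x).hasDerivAt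
  have hκ1C : ContDiff ℝ 2 (deriv κ) := by
    have h3 : ContDiff ℝ (2 + 1) κ := by exact_mod_cast hκC 3
    exact (contDiff_succ_iff_deriv.1 h3).2.2
  have hκ2 (x : ℝ) : HasDerivAt (deriv κ) (deriv (deriv κ) x) x :=
    (hκ1C.differentiable (by norm_num) x).hasDerivAt
  have hcases (x : ℝ) : (∀ᶠ y in 𝓝 x, 0 < P y) ∨ (κ : ℝ → ℝ) =ᶠ[𝓝 x] fun _ => 0 := by
    by_cases hx : x ∈ Metric.ball x₀ ρ
    · left
      filter_upwards [Metric.isOpen_ball.mem_nhds hx] with y hy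
      exact hρE hy
    · right
      refine notMem_tsupport_iff_eventuallyEq.1 ?_
      rw [κ.tsupport_eq, hout, Metric.mem_closedBall, not_le]
      rw [Metric.mem_ball, not_lt] at hx
      linarith [min_le_left ρ r]
  have hPC : ContDiff ℝ 2 P := contDiff_const.sub (contDiff_const.mul V.2.1)
  have hSC {x : ℝ} (hx : 0 < P x) : ContDiffAt ℝ 2 (fun y => √(P y)) x :=
    hPC.contDiffAt.sqrt hx.ne'
  -- Reduction of order: `√(P q)` is `|q'|`, and `q'` solves the homogeneous linearized equation.
  -- For `h = q' κ(q)` with `q' > 0`, `h'' + V''(q) h = (q'^2 (κ(q))')' / q'`, which is the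
  -- derivative of `P^{3/2} κ'` at `q`. Hence `W = -P^{3/2} κ'`, which is `C^2` although `V` is only
  -- `C^2`.
  let ψ : ℝ → ℝ := fun x => √(P x) * κ x
  let w : ℝ → ℝ := fun x => -(P x * √(P x) * deriv κ x)
  have hψC : ContDiff ℝ 2 ψ := by
    refine contDiff_iff_contDiffAt.2 fun x => ?_
    rcases hcases x with h | h
    · exact (hSC h.self_of_nhds).mul (hκC 2).contDiffAt
    · refine (contDiffAt_const (c := (0 : ℝ))).congr_of_eventuallyEq ?_
      filter_upwards [h] with y hy
      simp [ψ, hy]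
  have hwC : ContDiff ℝ 2 w := by
    refine contDiff_iff_contDiffAt.2 fun x => ?_
    rcases hcases x with h | h
    · exact ((hPC.contDiffAt.mul (hSC h.self_of_nhds)).mul hκ1C.contDiffAt).neg
    · refine (contDiffAt_const (c := (0 : ℝ))).congr_of_eventuallyEq ?_
      filter_upwards [h.deriv] with y hy
      simp [w, hy]
  have hwS : HasCompactSupport w := (κ.hasCompactSupport.deriv.mul_left).neg
  refine ⟨ψ, Cb.ofHasCompactSupport w hwC hwS, hψC,
    fun x => mul_nonneg (Real.sqrt_nonneg _) κ.nonneg, ?_, fun x hx => ?_, fun x => ?_⟩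
  · exact mul_pos (Real.sqrt_pos.2 hE) (κ.pos_of_mem_ball (Metric.mem_ball_self κ.rOut_pos))
  · have h1 : x ∈ Function.support κ := right_ne_zero_of_mul hx
    rw [κ.support_eq, Metric.mem_ball, Real.dist_eq, hout] at h1
    linarith [min_le_right ρ r]
  · change deriv (deriv ψ) x * P x - deriv ψ x * deriv V x + iteratedDeriv 2 V x * ψ x +
      deriv w x = 0
    rcases hcases x with h | h
    · have hP' (y : ℝ) : HasDerivAt P (-(2 * deriv V y)) y := by
        have := (((Cb.differentiable two_ne_zero V y).hasDerivAt).const_mul 2).const_sub E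
        exact this
      have hS {y : ℝ} (hy : 0 < P y) : HasDerivAt (fun z => √(P z)) (-deriv V y / √(P y)) y := by
        refine ((hP' y).sqrt hy.ne').congr_deriv ?_
        have := (Real.sqrt_pos.2 hy).ne'
        field_simp
      have hψ1 : deriv ψ =ᶠ[𝓝 x]
          fun y => -deriv V y / √(P y) * κ y + √(P y) * deriv κ y := by
        filter_upwards [h] with y hy
        exact ((hS hy).mul (hκ1 y)).deriv
      have hx := h.self_of_nhds
      have hsq : √(P x) ^ 2 = P x := Real.sq_sqrt hx.le
      have hS0 := (Real.sqrt_pos.2 hx).ne'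
      have hψ2 := ((((Cb.hasDerivAt_deriv V x).neg.div (hS hx) hS0).mul (hκ1 x)).add
        ((hS hx).mul (hκ2 x)))
      have hw := (((hP' x).mul (hS hx)).mul (hκ2 x)).neg
      have e1 : deriv (deriv ψ) x = _ := (hψ2.congr_of_eventuallyEq hψ1).deriv
      have e2 : deriv w x = _ := hw.deriv
      rw [e1, e2, hψ1.self_of_nhds]
      simp only [ψ, Pi.neg_apply, Pi.div_apply, Pi.mul_apply]
      generalize √(P x) = s at hsq hS0 ⊢
      rw [← hsq]
      field_simp
      ring
    · have hψ0 : ψ =ᶠ[𝓝 x] fun _ => 0 := by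
        filter_upwards [h] with y hy
        simp [ψ, hy]
      have hw0 : w =ᶠ[𝓝 x] fun _ => 0 := by
        filter_upwards [h.deriv] with y hy
        simp [w, hy]
      rw [hψ0.deriv.deriv_eq, hψ0.deriv_eq, hw0.deriv_eq, hψ0.self_of_nhds]
      simp

/-- The derivative is nonzero on a nonempty open set, and the cosine cannot vanish identically near
a point, since the sine would vanish there too. -/
theorem exists_deriv_ne_zero_and_cos_ne_zero {x : ℝ → ℝ} (hx : Differentiable ℝ x)
    (hx' : Continuous (deriv x)) (hnc : ¬ ∃ c : ℝ, ∀ t, x t = c) :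
    ∃ t, deriv x t ≠ 0 ∧ Real.cos t ≠ 0 := by
  obtain ⟨t₁, ht₁⟩ : ∃ t, deriv x t ≠ 0 := by
    by_contra! h
    exact hnc ⟨x 0, fun t => is_const_of_deriv_eq_zero hx h t 0⟩
  have hcos : ∃ᶠ t in 𝓝 t₁, Real.cos t ≠ 0 := by
    intro h
    have h0 : Real.cos =ᶠ[𝓝 t₁] fun _ => 0 := by
      filter_upwards [h] with t ht
      exact not_not.1 ht
    have hsin := h0.deriv_eq
    rw [Real.deriv_cos, deriv_const, neg_eq_zero] at hsin
    have h1 := Real.sin_sq_add_cos_sq t₁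
    rw [hsin, h0.self_of_nhds] at h1
    norm_num at h1
  obtain ⟨t, ht, ht'⟩ := (hcos.and_eventually (hx'.continuousAt.eventually_ne ht₁)).exists
  exact ⟨t, ht', ht⟩

/-- The bump function of a motion whose periods are periods of the cosine can be chosen so that
its cosine moment does not vanish. -/
theorem exists_cosMoment_ne_zero {T : ℝ} (hT : IsResonant T) {V : Potential}
    {q : EvenPeriodic T 2} (hq : IsMotion V q) (hnc : ¬ ∃ c : ℝ, ∀ t, q t = c)
    (hper : ∀ s, Function.Periodic q s → Function.Periodic Real.cos s) :
    ∃ (h : EvenPeriodic T 2) (W : Potential), cosMoment T h ≠ 0 ∧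
      ∀ t, iteratedDeriv 2 h t + iteratedDeriv 2 V (q t) * h t + deriv W (q t) = 0 := by
  have hT0 := hT.pos
  have hqc : Continuous q := q.1.2.1.continuous
  obtain ⟨t₀, ht₀, hcos₀⟩ := exists_deriv_ne_zero_and_cos_ne_zero hq.differentiable
    (continuous_iff_continuousAt.2 fun t => (hq.hasDerivAt_deriv t).continuousAt) hnc
  have hcos_eq (t : ℝ) (h : q t = q t₀) : Real.cos t = Real.cos t₀ := by
    rcases hq.periodic_sub_or_add_of_eq q.2.2 h with h1 | h1
    · have := hper _ h1 t₀
      rwa [add_sub_cancel] at this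
    · have := hper _ h1 (-t₀)
      rwa [Real.cos_neg, show -t₀ + (t + t₀) = t by ring] at this
  have hK : IsCompact (Icc t₀ (t₀ + T) ∩ {t | Real.cos t * Real.cos t₀ ≤ 0}) :=
    isCompact_Icc.inter_right (isClosed_le (by fun_prop) continuous_const)
  -- By compactness, `q` stays at distance at least `r` from `q t₀` wherever `cos` fails to have the
  -- sign of `cos t₀`; a profile supported within `r` of `q t₀` avoids these times.
  obtain ⟨r, hr, hrK⟩ := hK.exists_forall_le' (f := fun t => |q t - q t₀|) (a := 0)
    (by fun_prop) fun t ht => by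
      refine abs_pos.2 (sub_ne_zero.2 fun h => ?_)
      have h1 := ht.2
      rw [mem_ofPred_eq, hcos_eq t h, ← sq] at h1
      exact absurd h1 (not_le.2 (by positivity))
  have henergy (t : ℝ) : deriv q t ^ 2 = (deriv q t₀ ^ 2 + 2 * V (q t₀)) - 2 * V (q t) :=
    eq_sub_of_add_eq (hq.energy t t₀)
  obtain ⟨ψ, W, hψC, hψ0, hψ1, hψr, hψW⟩ := exists_localized_profile V
    (E := deriv q t₀ ^ 2 + 2 * V (q t₀)) (x₀ := q t₀) (r := r)
    (by rw [← henergy]; positivity) hr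
  let h : EvenPeriodic T 2 := EvenPeriodic.mk hT0.ne' (fun t => ψ (q t)) (hψC.comp q.1.2.1)
    (fun t => congrArg ψ (q.2.1 t)) (fun t => congrArg ψ (q.2.2 t))
  have hcosT := hT.periodic_cos
  refine ⟨h, W, fun h0 => ?_, fun t => ?_⟩
  · rw [cosMoment_apply] at h0
    -- The factor `cos t₀` makes the integrand nonnegative.
    have hpos : 0 < ∫ t in t₀..(t₀ + T), Real.cos t * h t * Real.cos t₀ := by
      have hc : Continuous fun t => Real.cos t * h t * Real.cos t₀ :=
        (Real.continuous_cos.mul h.1.2.1.continuous).mul continuous_const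
      refine intervalIntegral.integral_pos (by linarith) hc.continuousOn (fun t ht => ?_)
        ⟨t₀, ⟨le_rfl, by linarith⟩, ?_⟩
      · by_cases hz : ψ (q t) = 0
        · have : h t = 0 := hz
          rw [this, mul_zero, zero_mul]
        · have h1 : 0 < Real.cos t * Real.cos t₀ := by
            by_contra hneg
            exact absurd (hψr _ hz) (not_lt.2 (hrK t ⟨Ioc_subset_Icc_self ht, not_lt.1 hneg⟩))
          have h2 : 0 ≤ h t := hψ0 _
          rw [mul_right_comm]
          positivity
      · have h2 : 0 < h t₀ := hψ1
        rw [mul_right_comm, ← sq]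
        positivity
    have hshift : ∫ t in t₀..(t₀ + T), Real.cos t * h t =
        ∫ t in (0 : ℝ)..(0 + T), Real.cos t * h t :=
      (hcosT.mul h.2.1).intervalIntegral_add_eq t₀ 0
    rw [intervalIntegral.integral_mul_const, hshift, zero_add, h0, zero_mul] at hpos
    exact hpos.false
  · have hψd (x : ℝ) : HasDerivAt ψ (deriv ψ x) x :=
      (hψC.differentiable (by norm_num) x).hasDerivAt
    have hψd' (x : ℝ) : HasDerivAt (deriv ψ) (deriv (deriv ψ) x) x :=
      ((hψC.differentiable_deriv_two) x).hasDerivAt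
    have h1 : deriv h = fun t => deriv ψ (q t) * deriv q t :=
      funext fun t => ((hψd (q t)).comp t (hq.differentiable t).hasDerivAt).deriv
    have h2 : iteratedDeriv 2 h t = deriv (deriv ψ) (q t) * deriv q t * deriv q t +
        deriv ψ (q t) * -deriv V (q t) := by
      rw [iteratedDeriv_succ, iteratedDeriv_one, h1]
      exact (((hψd' (q t)).comp t (hq.differentiable t).hasDerivAt).mul
        (hq.hasDerivAt_deriv t)).deriv
    have h3 := hψW (q t)
    rw [← henergy] at h3
    have h4 : h t = ψ (q t) := rfl
    rw [h2, h4]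
    linear_combination h3

/-- The cosine moment of the motion has no critical points as a function of the potential. -/
theorem IsPerturbationNhd.fderiv_cosMoment_ne_zero {T : ℝ} (hT : IsResonant T) {U : Set Potential}
    {f : Potential → EvenPeriodic T 2} {q₀ : EvenPeriodic T 2} {V₀ : Potential}
    (hU : IsPerturbationNhd U f q₀ V₀)
    (hper : ∀ V ∈ U, ∃ W ∈ connectedComponentIn U V, ∃ p : ℝ,
      IsMinimalPeriod (f W) p ∧ IsResonant p)
    {V : Potential} (hV : V ∈ U) : fderiv ℝ (fun W => cosMoment T (f W)) V ≠ 0 := by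
  have han := hU.2.2.2.1 V hV
  obtain ⟨h, W, hne, hW⟩ := exists_cosMoment_ne_zero hT (isMotion_of_newton_eq_zero han.2.1) han.1
    fun s hs => hU.periodic_cos hT.pos hper hV hs
  -- Both sides solve the same inhomogeneous linear equation, so anharmonicity kills their
  -- difference.
  have hfW : fderiv ℝ f V W = h := by
    refine sub_eq_zero.1 (han.eq_zero_of_linearized fun t => ?_)
    have h1 := hU.linearized hV W t
    have h2 := hW t
    have h3 := map_sub (EvenPeriodic.evalDeriv T 2 2 le_rfl t) (fderiv ℝ f V W) h
    have h4 := map_sub (EvenPeriodic.evalDeriv T 2 0 (Nat.zero_le 2) t) (fderiv ℝ f V W) h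
    simp only [EvenPeriodic.evalDeriv_zero_apply] at h4
    simp only [EvenPeriodic.evalDeriv_apply] at h3
    rw [h3, h4]
    linear_combination h1 - h2
  have hdf : DifferentiableAt ℝ f V :=
    (hU.2.2.1.contDiffAt (hU.1.mem_nhds hV)).differentiableAt one_ne_zero
  have hd : HasFDerivAt (fun W => cosMoment T (f W)) ((cosMoment T).comp (fderiv ℝ f V)) V :=
    (cosMoment T).hasFDerivAt.comp V hdf.hasFDerivAt
  rw [hd.fderiv]
  intro h0
  apply hne
  rw [← hfW]
  exact congrArg (fun L : Potential →L[ℝ] ℝ => L W) h0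

/-! ### The off-central tangent component -/

theorem contDiff_two_of_hasDerivAt {x x' x'' : ℝ → ℝ} (h : ∀ t, HasDerivAt x (x' t) t)
    (h' : ∀ t, HasDerivAt x' (x'' t) t) (hc : Continuous x'') :
    ContDiff ℝ 2 x ∧ ∀ t, iteratedDeriv 2 x t = x'' t := by
  have e1 : deriv x = x' := funext fun t => (h t).deriv
  have e2 : deriv x' = x'' := funext fun t => (h' t).deriv
  constructor
  · have h1 : ContDiff ℝ (1 + 1) x := by
      refine contDiff_succ_iff_deriv.2 ⟨fun t => (h t).differentiableAt, by simp, ?_⟩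
      rw [e1, contDiff_one_iff_deriv, e2]
      exact ⟨fun t => (h' t).differentiableAt, hc⟩
    rwa [one_add_one_eq_two] at h1
  · intro t
    rw [iteratedDeriv_succ, iteratedDeriv_one, e1, e2]

theorem hasDerivAt_of_contDiff_two {x : ℝ → ℝ} (hx : ContDiff ℝ 2 x) (t : ℝ) :
    HasDerivAt x (deriv x t) t ∧ HasDerivAt (deriv x) (iteratedDeriv 2 x t) t := by
  refine ⟨(hx.differentiable (by norm_num) t).hasDerivAt, ?_⟩
  rw [iteratedDeriv_succ, iteratedDeriv_one]
  exact (hx.differentiable_deriv_two t).hasDerivAt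

/-- A solution of `u'' + u = 0` with vanishing Cauchy data vanishes. -/
theorem harmonic_eq_zero {u u' : ℝ → ℝ} (h : ∀ t, HasDerivAt u (u' t) t)
    (h' : ∀ t, HasDerivAt u' (-u t) t) {t₀ : ℝ} (h0 : u t₀ = 0) (h0' : u' t₀ = 0) (t : ℝ) :
    u t = 0 := by
  have hd (t : ℝ) : HasDerivAt (fun t => u t ^ 2 + u' t ^ 2) 0 t := by
    refine (((h t).pow 2).add ((h' t).pow 2)).congr_deriv ?_
    simp
    ring
  have h1 := is_const_of_deriv_eq_zero (fun t => (hd t).differentiableAt)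
    (fun t => (hd t).deriv) t t₀
  simp only [h0, h0'] at h1
  nlinarith [sq_nonneg (u t), sq_nonneg (u' t)]

/-- A solution of `χ'' + χ = x` is symmetric about each critical point which is a centre of
symmetry of `x`. -/
theorem symmetric_of_deriv_eq_zero {x χ χ' : ℝ → ℝ} (h : ∀ t, HasDerivAt χ (χ' t) t)
    (h' : ∀ t, HasDerivAt χ' (x t - χ t) t) {a : ℝ} (ha : χ' (a / 2) = 0)
    (hx : ∀ t, x (a - t) = x t) (t : ℝ) : χ (a - t) = χ t := by
  have h1 (t : ℝ) : HasDerivAt (fun t => χ (a - t) - χ t) (-χ' (a - t) - χ' t) t :=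
    ((h (a - t)).comp_const_sub a t).sub (h t)
  have h2 (t : ℝ) : HasDerivAt (fun t => -χ' (a - t) - χ' t) (-(χ (a - t) - χ t)) t := by
    refine (((h' (a - t)).comp_const_sub a t).neg.sub (h' t)).congr_deriv ?_
    rw [hx]
    ring
  have hmid : a - a / 2 = a / 2 := by ring
  exact sub_eq_zero.1 (harmonic_eq_zero h1 h2 (t₀ := a / 2) (by rw [hmid, sub_self])
    (by rw [hmid, ha]; simp) t)

/-- The numerator of the initial value of the off-central component. -/
def offCentralMoment (τ : ℝ) (x : ℝ → ℝ) : ℝ :=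
  ∫ s in (0 : ℝ)..τ / 2, Real.cos (τ / 2 - s) * x s

theorem IsOffCentral.deriv_half {τ : ℝ} {x χ : ℝ → ℝ} (h : IsOffCentral τ x χ) :
    deriv χ (τ / 2) = 0 :=
  IsMotion.deriv_eq_zero_of_periodic h.2.1 (by
    rw [mul_div_cancel₀ _ two_ne_zero]
    exact h.2.2.1)

theorem deriv_zero_of_even {χ : ℝ → ℝ} (h : Function.Even χ) : deriv χ 0 = 0 :=
  IsMotion.deriv_eq_zero_of_periodic h fun t => by rw [mul_zero, add_zero]

/-- Pair the equation with `cos (τ / 2 - s)`, a solution of the homogeneous one, and integrate by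
parts twice. As `χ'` vanishes at `0` and `τ / 2`, only the boundary term `χ 0 * sin (τ / 2)`
remains. -/
theorem IsOffCentral.apply_zero_mul_sin {τ : ℝ} {x χ : ℝ → ℝ} (hx : Continuous x)
    (h : IsOffCentral τ x χ) : χ 0 * Real.sin (τ / 2) = offCentralMoment τ x := by
  have hd := hasDerivAt_of_contDiff_two h.1
  set a := τ / 2 with ha
  have hΦ (s : ℝ) : HasDerivAt (fun s => deriv χ s * Real.cos (a - s) - χ s * Real.sin (a - s))
      (Real.cos (a - s) * x s) s := by
    refine ((((hd s).2).mul ((Real.hasDerivAt_cos (a - s)).comp_const_sub a s)).sub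
      ((hd s).1.mul ((Real.hasDerivAt_sin (a - s)).comp_const_sub a s))).congr_deriv ?_
    rw [← h.2.2.2 s]
    ring
  have hint := intervalIntegral.integral_eq_sub_of_hasDerivAt (a := 0) (b := a) (fun s _ => hΦ s)
    (Continuous.intervalIntegrable (by fun_prop) _ _)
  rw [offCentralMoment, ← ha, hint, h.deriv_half, deriv_zero_of_even h.2.1]
  simp

theorem IsOffCentral.unique {τ : ℝ} {x χ₁ χ₂ : ℝ → ℝ} (hx : Continuous x)
    (hτ : Real.sin (τ / 2) ≠ 0) (h₁ : IsOffCentral τ x χ₁) (h₂ : IsOffCentral τ x χ₂) :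
    χ₁ = χ₂ := by
  have h0 : χ₁ 0 = χ₂ 0 := mul_right_cancel₀ hτ
    ((h₁.apply_zero_mul_sin hx).trans (h₂.apply_zero_mul_sin hx).symm)
  have hd₁ := hasDerivAt_of_contDiff_two h₁.1
  have hd₂ := hasDerivAt_of_contDiff_two h₂.1
  funext t
  refine sub_eq_zero.1 (harmonic_eq_zero (u := fun t => χ₁ t - χ₂ t)
    (fun t => (hd₁ t).1.sub (hd₂ t).1) (fun t => ((hd₁ t).2.sub (hd₂ t).2).congr_deriv ?_)
    (t₀ := 0) (sub_eq_zero.2 h0) ?_ t)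
  · linear_combination h₁.2.2.2 t - h₂.2.2.2 t
  · rw [deriv_zero_of_even h₁.2.1, deriv_zero_of_even h₂.2.1, sub_self]

/-- Variation of constants gives the solutions with `χ'(0) = 0`; the coefficient `A` is chosen so
that `χ'(τ/2) = 0`. Symmetry about `0` and `τ / 2` then yields evenness and periodicity. -/
theorem exists_isOffCentral {τ : ℝ} {x : ℝ → ℝ} (hx : Continuous x) (he : Function.Even x)
    (hp : Function.Periodic x τ) (hτ : Real.sin (τ / 2) ≠ 0) : ∃ χ, IsOffCentral τ x χ := by
  let C : ℝ → ℝ := fun t => ∫ s in (0 : ℝ)..t, Real.cos s * x s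
  let S : ℝ → ℝ := fun t => ∫ s in (0 : ℝ)..t, Real.sin s * x s
  have hC (t : ℝ) : HasDerivAt C (Real.cos t * x t) t :=
    (Real.continuous_cos.mul hx).integral_hasStrictDerivAt 0 t |>.hasDerivAt
  have hS (t : ℝ) : HasDerivAt S (Real.sin t * x t) t :=
    (Real.continuous_sin.mul hx).integral_hasStrictDerivAt 0 t |>.hasDerivAt
  let A := offCentralMoment τ x / Real.sin (τ / 2)
  have hA : A * Real.sin (τ / 2) =
      Real.cos (τ / 2) * C (τ / 2) + Real.sin (τ / 2) * S (τ / 2) := by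
    rw [div_mul_cancel₀ _ hτ, offCentralMoment, ← intervalIntegral.integral_const_mul,
      ← intervalIntegral.integral_const_mul, ← intervalIntegral.integral_add
        (Continuous.intervalIntegrable (by fun_prop) _ _)
        (Continuous.intervalIntegrable (by fun_prop) _ _)]
    refine intervalIntegral.integral_congr fun s _ => ?_
    simp only [Real.cos_sub]
    ring
  let χ : ℝ → ℝ := fun t => A * Real.cos t + (Real.sin t * C t - Real.cos t * S t)
  let χ' : ℝ → ℝ := fun t => A * -Real.sin t + (Real.cos t * C t + Real.sin t * S t)
  have h1 (t : ℝ) : HasDerivAt χ (χ' t) t := by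
    refine (((Real.hasDerivAt_cos t).const_mul A).add
      (((Real.hasDerivAt_sin t).mul (hC t)).sub
        ((Real.hasDerivAt_cos t).mul (hS t)))).congr_deriv ?_
    simp only [χ']
    ring
  have h2 (t : ℝ) : HasDerivAt χ' (x t - χ t) t := by
    refine (((Real.hasDerivAt_sin t).neg.const_mul A).add
      (((Real.hasDerivAt_cos t).mul (hC t)).add
        ((Real.hasDerivAt_sin t).mul (hS t)))).congr_deriv ?_
    simp only [χ]
    linear_combination x t * Real.sin_sq_add_cos_sq t
  have hχc : Continuous χ := continuous_iff_continuousAt.2 fun t => (h1 t).continuousAt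
  obtain ⟨hC2, hdd⟩ := contDiff_two_of_hasDerivAt h1 h2 (hx.sub hχc)
  have heven : Function.Even χ := fun t => by
    have := symmetric_of_deriv_eq_zero h1 h2 (a := 0) (by simp [χ', C])
      (fun t => by rw [zero_sub, he]) t
    rwa [zero_sub] at this
  refine ⟨χ, hC2, heven, fun t => ?_, fun t => by rw [hdd t]; ring⟩
  have hsymm := symmetric_of_deriv_eq_zero h1 h2 (a := τ) (by
    simp only [χ']
    linear_combination -hA) (fun t => by
      rw [← he, neg_sub, ← hp (t - τ), sub_add_cancel]) (-t)
  rw [heven t, sub_neg_eq_add, add_comm] at hsymm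
  exact hsymm

theorem IsResonant.sin_half {T : ℝ} (hT : IsResonant T) : Real.sin (T / 2) = 0 := by
  obtain ⟨n, -, rfl⟩ := hT
  rw [show 2 * Real.pi * n / 2 = n * Real.pi by ring]
  exact Real.sin_nat_mul_pi n

/-- At a resonant period the numerator is half the cosine moment, up to sign. -/
theorem two_mul_offCentralMoment {T : ℝ} (hT : IsResonant T) {q : ℝ → ℝ} (hq : Continuous q)
    (he : Function.Even q) (hp : Function.Periodic q T) :
    2 * offCentralMoment T q = Real.cos (T / 2) * ∫ t in (0 : ℝ)..T, Real.cos t * q t := by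
  have hc : Continuous fun t => Real.cos t * q t := by fun_prop
  have h1 : offCentralMoment T q =
      Real.cos (T / 2) * ∫ t in (0 : ℝ)..T / 2, Real.cos t * q t := by
    rw [offCentralMoment, ← intervalIntegral.integral_const_mul]
    refine intervalIntegral.integral_congr fun s _ => ?_
    simp only [Real.cos_sub, hT.sin_half]
    ring
  have h2 : ∫ t in (0 : ℝ)..T / 2, Real.cos t * q t = ∫ t in T / 2..T, Real.cos t * q t := by
    have h3 := intervalIntegral.integral_comp_sub_left (fun t => Real.cos t * q t)
      (a := 0) (b := T / 2) T
    rw [sub_zero, show T - T / 2 = T / 2 by ring] at h3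
    rw [← h3]
    refine intervalIntegral.integral_congr fun s _ => ?_
    have h4 : Real.cos (T - s) = Real.cos s := by
      rw [← Real.cos_neg, neg_sub, ← hT.periodic_cos (s - T), sub_add_cancel]
    have h5 : q (T - s) = q s := by
      rw [← he, neg_sub, ← hp (s - T), sub_add_cancel]
    simp only [h4, h5]
  rw [h1, ← intervalIntegral.integral_add_adjacent_intervals
    (hc.intervalIntegrable 0 (T / 2)) (hc.intervalIntegrable (T / 2) T), ← h2]
  ring

theorem IsOscillationFamily.continuousAt_offCentralMoment {V : Potential} {T : ℝ} {q : ℝ → ℝ}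
    {δ : ℝ} (hδ : 0 < δ) {x : ℝ → ℝ → ℝ} (hx : IsOscillationFamily V T q δ x) :
    ContinuousAt (fun τ => offCentralMoment τ (x τ)) T := by
  -- Clamping `τ` extends the family continuously to all of `ℝ × ℝ` without changing it near `T`.
  let ρ : ℝ → ℝ := fun τ => max (T - δ / 2) (min τ (T + δ / 2))
  have hρ : Continuous ρ := by fun_prop
  have hρmem (τ : ℝ) : ρ τ ∈ Ioo (T - δ) (T + δ) :=
    ⟨lt_max_of_lt_left (by linarith), max_lt (by linarith) (min_lt_of_right_lt (by linarith))⟩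
  have hy : Continuous fun z : ℝ × ℝ => x (ρ z.1) z.2 :=
    hx.2.1.comp_continuous (f := fun z : ℝ × ℝ => (ρ z.1, z.2)) (by fun_prop)
      fun z => ⟨hρmem z.1, mem_univ _⟩
  have hcont : Continuous fun τ => offCentralMoment τ (x (ρ τ)) := by
    refine intervalIntegral.continuous_parametric_intervalIntegral_of_continuous
      (f := fun τ s => Real.cos (τ / 2 - s) * x (ρ τ) s) ?_ (continuous_id.div_const 2)
    have h1 : Continuous fun z : ℝ × ℝ => Real.cos (z.1 / 2 - z.2) := by fun_prop
    exact h1.mul hy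
  refine hcont.continuousAt.congr ?_
  filter_upwards [Icc_mem_nhds (show T - δ / 2 < T by linarith) (show T < T + δ / 2 by linarith)]
    with τ hτ
  have : ρ τ = τ := by
    simp only [ρ]
    rw [min_eq_left hτ.2, max_eq_right hτ.1]
  rw [this]

/-- Dividing numerator and denominator of `χ₁(0)` by `cos (T / 2)` leaves a numerator `J` tending to
half the cosine moment, over `sin ((τ - T) / 2)`, which changes sign at `T`. -/
theorem IsOscillationFamily.hasSignChangeAt {V : Potential} {T : ℝ} (hT : IsResonant T)
    {q : EvenPeriodic T 2} (hq : ∫ t in (0 : ℝ)..T, Real.cos t * q t ≠ 0) {δ : ℝ} (hδ : 0 < δ)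
    {x : ℝ → ℝ → ℝ} (hx : IsOscillationFamily V T q δ x) : HasSignChangeAt T x := by
  have hcos : Real.cos (T / 2) ≠ 0 := by
    intro h
    have h1 := Real.sin_sq_add_cos_sq (T / 2)
    rw [h, hT.sin_half] at h1
    norm_num at h1
  set J : ℝ → ℝ := fun τ => offCentralMoment τ (x τ) / Real.cos (T / 2) with hJ
  have hJT : Tendsto J (𝓝 T) (𝓝 ((∫ t in (0 : ℝ)..T, Real.cos t * q t) / 2)) := by
    have h1 := (hx.continuousAt_offCentralMoment hδ).div_const (Real.cos (T / 2))
    have h2 : offCentralMoment T (x T) / Real.cos (T / 2) =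
        (∫ t in (0 : ℝ)..T, Real.cos t * q t) / 2 := by
      rw [hx.1, div_eq_div_iff hcos two_ne_zero, mul_comm,
        two_mul_offCentralMoment hT q.1.2.1.continuous q.2.2 q.2.1, mul_comm]
    rw [← h2]
    exact h1
  have hsin (τ : ℝ) : Real.sin (τ / 2) = Real.cos (T / 2) * Real.sin ((τ - T) / 2) := by
    rw [show τ / 2 = T / 2 + (τ - T) / 2 by ring, Real.sin_add, hT.sin_half]
    ring
  have hlim : Tendsto (fun τ => Real.sin ((τ - T) / 2)) (𝓝 T) (𝓝 0) := by
    have : Continuous fun τ => Real.sin ((τ - T) / 2) := by fun_prop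
    simpa using this.tendsto T
  have hpi := Real.pi_pos
  have hright : ∀ᶠ τ in 𝓝[>] T, 0 < Real.sin ((τ - T) / 2) := by
    filter_upwards [Ioo_mem_nhdsGT (show T < T + Real.pi by linarith)] with τ hτ
    exact Real.sin_pos_of_pos_of_lt_pi (by linarith [hτ.1]) (by linarith [hτ.2])
  have hleft : ∀ᶠ τ in 𝓝[<] T, Real.sin ((τ - T) / 2) < 0 := by
    filter_upwards [Ioo_mem_nhdsLT (show T - Real.pi < T by linarith)] with τ hτ
    exact Real.sin_neg_of_neg_of_neg_pi_lt (by linarith [hτ.2]) (by linarith [hτ.1])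
  have hne : ∀ᶠ τ in 𝓝[≠] T, Real.sin ((τ - T) / 2) ≠ 0 := by
    rw [← nhdsLT_sup_nhdsGT, eventually_sup]
    exact ⟨hleft.mono fun _ h => h.ne, hright.mono fun _ h => h.ne'⟩
  have hinvr : Tendsto (fun τ => (Real.sin ((τ - T) / 2))⁻¹) (𝓝[>] T) atTop :=
    tendsto_inv_nhdsGT_zero.comp (tendsto_nhdsWithin_iff.2 ⟨hlim.mono_left inf_le_left, hright⟩)
  have hinvl : Tendsto (fun τ => (Real.sin ((τ - T) / 2))⁻¹) (𝓝[<] T) atBot :=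
    tendsto_inv_nhdsLT_zero.comp (tendsto_nhdsWithin_iff.2 ⟨hlim.mono_left inf_le_left, hleft⟩)
  have hJr := hJT.mono_left (inf_le_left : 𝓝[>] T ≤ 𝓝 T)
  have hJl := hJT.mono_left (inf_le_left : 𝓝[<] T ≤ 𝓝 T)
  refine ⟨fun τ => J τ * (Real.sin ((τ - T) / 2))⁻¹, ?_, ?_⟩
  · filter_upwards [hne, mem_nhdsWithin_of_mem_nhds
      (Ioo_mem_nhds (show T - δ < T by linarith) (show T < T + δ by linarith))] with τ hτ hτδ
    obtain ⟨hxC, hxe, hxp, -⟩ := hx.2.2 τ hτδ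
    have hτ' : Real.sin (τ / 2) ≠ 0 := by
      rw [hsin]
      exact mul_ne_zero hcos hτ
    obtain ⟨χ, hχ⟩ := exists_isOffCentral hxC.continuous hxe hxp hτ'
    refine ⟨⟨χ, hχ, fun ξ hξ => hξ.unique hxC.continuous hτ' hχ⟩, fun ξ hξ => ?_⟩
    have h1 := hξ.apply_zero_mul_sin hxC.continuous
    rw [hsin] at h1
    simp only [hJ]
    rw [← h1]
    field_simp
  · rcases lt_or_gt_of_ne hq with h | h
    · right
      exact ⟨hJl.neg_mul_atBot (by linarith) hinvl, hJr.neg_mul_atTop (by linarith) hinvr⟩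
    · left
      exact ⟨hJl.pos_mul_atBot (by linarith) hinvl, hJr.pos_mul_atTop (by linarith) hinvr⟩

/-! ### Continuation in the period -/

theorem EvenPeriodic.continuous_eval (T : ℝ) :
    Continuous fun z : EvenPeriodic T 2 × ℝ => z.1 z.2 := by
  have h1 : Continuous fun z : EvenPeriodic T 2 × ℝ => (Cb.jet 2 z.1.1 0, z.2) :=
    (((continuous_apply 0).comp (Cb.isometry_jet 2).continuous).comp
      (continuous_subtype_val.comp continuous_fst)).prodMk continuous_snd
  refine ((ContinuousEval.continuous_eval (F := ℝ →ᵇ ℝ)).comp h1).congr fun z => ?_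
  change iteratedDeriv 0 z.1 z.2 = z.1 z.2
  rw [iteratedDeriv_zero]

/-- Rescaling the potential and time continues a motion to the neighbouring periods. -/
theorem IsPerturbationNhd.exists_isOscillationFamily {T : ℝ} (hT : 0 < T) {U : Set Potential}
    {f : Potential → EvenPeriodic T 2} {q₀ : EvenPeriodic T 2} {V₀ : Potential}
    (hU : IsPerturbationNhd U f q₀ V₀) {V : Potential} (hV : V ∈ U) :
    ∃ δ > 0, ∃ x : ℝ → ℝ → ℝ, IsOscillationFamily V T (f V) δ x := by
  obtain ⟨hUo, -, hf, han, -⟩ := hU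
  -- If `q` has period `T` and solves Newton's equation for `(τ / T)^2 V`, then `t ↦ q (T t / τ)`
  -- has period `τ` and solves it for `V`.
  let Λ : ℝ → Potential := fun τ => (τ / T) ^ 2 • V
  have hΛ : Continuous Λ := by fun_prop
  have hΛT : Λ T = V := by simp [Λ, hT.ne']
  obtain ⟨ε, hε, hεU⟩ := Metric.eventually_nhds_iff.1
    (hΛ.continuousAt.eventually_mem (x := T) (by rw [hΛT]; exact hUo.mem_nhds hV))
  -- The bound by `T` keeps `τ` positive.
  have hmem (τ : ℝ) (hτ : τ ∈ Ioo (T - min ε T) (T + min ε T)) : Λ τ ∈ U ∧ 0 < τ := by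
    refine ⟨hεU ?_, by linarith [hτ.1, min_le_right ε T]⟩
    rw [Real.dist_eq, abs_lt]
    constructor <;> linarith [hτ.1, hτ.2, min_le_left ε T]
  refine ⟨min ε T, lt_min hε hT, fun τ t => f (Λ τ) (T / τ * t), ?_, ?_, fun τ hτ => ?_⟩
  · funext t
    change f (Λ T) (T / T * t) = f V t
    rw [hΛT, div_self hT.ne', one_mul]
  · refine (EvenPeriodic.continuous_eval T).comp_continuousOn
      (f := fun z : ℝ × ℝ => (f (Λ z.1), T / z.1 * z.2)) (ContinuousOn.prodMk ?_ ?_)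
    · exact hf.continuousOn.comp (hΛ.comp continuous_fst).continuousOn
        fun z hz => (hmem z.1 hz.1).1
    · exact (continuousOn_const.div continuousOn_fst fun z hz => (hmem z.1 hz.1).2.ne').mul
        continuousOn_snd
  · obtain ⟨hτU, hτ0⟩ := hmem τ hτ
    have hmot := isMotion_of_newton_eq_zero (han _ hτU).2.1
    set q := f (Λ τ)
    have hscale (t : ℝ) : HasDerivAt (fun t => T / τ * t) (T / τ) t := by
      simpa using (hasDerivAt_id t).const_mul (T / τ)
    have hd1 (t : ℝ) : HasDerivAt (fun t => q (T / τ * t)) (deriv q (T / τ * t) * (T / τ)) t :=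
      HasDerivAt.comp t (h₂ := q) (hmot.differentiable (T / τ * t)).hasDerivAt (hscale t)
    have hd2 (t : ℝ) : HasDerivAt (fun t => deriv q (T / τ * t) * (T / τ))
        (-deriv V (q (T / τ * t))) t := by
      refine ((HasDerivAt.comp t (h₂ := deriv q) (hmot.hasDerivAt_deriv (T / τ * t))
        (hscale t)).mul_const (T / τ)).congr_deriv ?_
      have hΛd : deriv (Λ τ) (q (T / τ * t)) = (τ / T) ^ 2 * deriv V (q (T / τ * t)) := by
        have := map_smul (Cb.evalDeriv 2 1 one_le_two (q (T / τ * t))) ((τ / T) ^ 2) V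
        simpa only [Cb.evalDeriv_apply, iteratedDeriv_one, smul_eq_mul] using this
      rw [hΛd]
      field_simp
    have hc : Continuous fun t => -deriv V (q (T / τ * t)) := by
      have h1 : Continuous (deriv V) := V.2.1.continuous_deriv (by norm_num)
      exact (h1.comp (q.1.2.1.continuous.comp (continuous_const.mul continuous_id))).neg
    obtain ⟨hC2, hdd⟩ := contDiff_two_of_hasDerivAt hd1 hd2 hc
    refine ⟨hC2, fun t => ?_, fun t => ?_, fun t => ?_⟩
    · change q (T / τ * -t) = q (T / τ * t)
      rw [mul_neg]
      exact q.2.2 _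
    · change q (T / τ * (t + τ)) = q (T / τ * t)
      rw [mul_add, div_mul_cancel₀ _ hτ0.ne']
      exact q.2.1 _
    · rw [hdd]
      exact neg_add_cancel _

end Breather

end

theorem mainTheorem1 (T : ℝ) (hT : Breather.IsResonant T)
    (V₀ : Breather.Potential) (q₀ : Breather.EvenPeriodic T 2)
    (hdeg : Breather.IsDegenerate V₀ q₀)
    (U : Set Breather.Potential) (f : Breather.Potential → Breather.EvenPeriodic T 2)
    (hU : Breather.IsPerturbationNhd U f q₀ V₀)
    (hper : ∀ V ∈ U, ∃ W ∈ connectedComponentIn U V, ∃ p : ℝ,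
      Breather.IsMinimalPeriod (f W) p ∧ Breather.IsResonant p) :
    -- the potentials on which degeneracy persists form a submanifold of codimension one
    Breather.IsSubmanifoldOfCodim 1 U {V ∈ U | Breather.IsDegenerate V (f V)} ∧
    -- the other potentials in `U` form an open dense subset of `U`
    IsOpen {V ∈ U | ¬ Breather.IsDegenerate V (f V)} ∧
    U ⊆ closure {V ∈ U | ¬ Breather.IsDegenerate V (f V)} ∧
    -- and on them `χ₁(0)` has a vertical asymptote with a sign change at the period `T`
    ∀ V ∈ U, ¬ Breather.IsDegenerate V (f V) →
      (∃ δ > 0, ∃ x : ℝ → ℝ → ℝ, Breather.IsOscillationFamily V T (f V) δ x) ∧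
      ∀ δ > 0, ∀ x : ℝ → ℝ → ℝ, Breather.IsOscillationFamily V T (f V) δ x →
        Breather.HasSignChangeAt T x := by
  have hg : ContDiffOn ℝ 1 (fun V => Breather.cosMoment T (f V)) U :=
    (Breather.cosMoment T).contDiff.comp_contDiffOn hU.2.2.1
  have hreg : ∀ V ∈ U, Breather.cosMoment T (f V) = 0 →
      fderiv ℝ (fun V => Breather.cosMoment T (f V)) V ≠ 0 :=
    fun V hV _ => hU.fderiv_cosMoment_ne_zero hT hper hV
  have hiff (V : Breather.Potential) (hV : V ∈ U) :
      Breather.IsDegenerate V (f V) ↔ Breather.cosMoment T (f V) = 0 :=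
    ⟨fun h => h.2, fun h => ⟨hU.2.2.2.1 V hV, h⟩⟩
  have hD : {V ∈ U | Breather.IsDegenerate V (f V)} =
      {V ∈ U | Breather.cosMoment T (f V) = 0} :=
    Set.ext fun V => and_congr_right (hiff V)
  have hD' : {V ∈ U | ¬ Breather.IsDegenerate V (f V)} =
      {V ∈ U | Breather.cosMoment T (f V) ≠ 0} :=
    Set.ext fun V => and_congr_right fun hV => not_congr (hiff V hV)
  rw [hD, hD']
  refine ⟨Breather.isSubmanifoldOfCodim_one_of_regular hU.1 hg hreg, ?_,
    Breather.subset_closure_ne_zero_of_regular hU.1 hreg, fun V hV hnd => ?_⟩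
  · exact hg.continuousOn.isOpen_inter_preimage hU.1 isOpen_compl_singleton
  · exact ⟨hU.exists_isOscillationFamily hT.pos hV, fun δ hδ x hx =>
      hx.hasSignChangeAt hT ((not_congr (hiff V hV)).1 hnd) hδ⟩
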